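/- Let $p>2$ be a prime, let $k$ be an algebraically closed field of characteristic $p$, and let $G=\mathrm{SL}_2(\mathbb{F}_p)$. For $m\ge 1$ let $V_m$ be the $m$-dimensional $kG$-module of homogeneous polynomials of degree $m-1$ in $X,Y$ over $k$, where $\begin{pmatrix}a&b\\c&d\end{pmatrix}$ sends $f(X,Y)$ to $f(aX+cY,\,bX+dY)$. Fix $n\in\{1,\dots,p-1\}$. Let $A^{(n)}$ be the $(p-1)\times(p-1)$ matrix whose $(i,j)$ entry ($1\le i,j\le p-1$) is the multiplicity of $V_j$ as a direct summand of $V_i\otimes V_n$, i.e. the largest $m$ such that $V_j^{\oplus m}$ is isomorphic to a direct summand of $V_i\otimes V_n$. Then: 1. $A^{(n)}$ is symmetric with entries in $\{0,1\}$, so it is the adjacency matrix of an undirected graph (with loops) $\mathcal{G}^{(n)}$ on the vertices $1,\dots,p-1$. Let $d(i)$ denote the degree of $i$ in $\mathcal{G}^{(n)}$, a loop contributing $1$. 2. For every $1\le i\le p-1$, the module $V_i\otimes V_n$ has a decomposition into finitely many indecomposable summands, and in every such decomposition the number of non-projective summands is $d(i)$. 3. For every $1\le i\le p-1$, $d(i)=\min\{i,\;p-i,\;n,\;p-n\}$.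 4. $\displaystyle\sum_{i=1}^{p-1} d(i)=n(p-n)$. -/

import Mathlib

/-! ### Modules: indecomposability, decompositions, multiplicities -/

/-- A module is indecomposable if it is nonzero and is not the internal direct sum of two nonzero
submodules. -/
def IsIndecomposableModule (R M : Type*) [Ring R] [AddCommMonoid M] [Module R M] : Prop :=
  Nontrivial M ∧ ∀ N₁ N₂ : Submodule R M, IsCompl N₁ N₂ → N₁ = ⊥ ∨ N₂ = ⊥

/-- The finite family of submodules `W` is a decomposition of `M` into indecomposable summands. -/
def IsIndecomposableDecomposition {R M : Type*} [Ring R] [AddCommMonoid M] [Module R M]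
    {r : ℕ} (W : Fin r → Submodule R M) : Prop :=
  DirectSum.IsInternal W ∧ ∀ s, IsIndecomposableModule R (W s)

/-- The number of non-projective members (counted with multiplicity) of a finite family of
submodules. -/
noncomputable def numNonProjective {R M : Type*} [Ring R] [AddCommMonoid M] [Module R M]
    {r : ℕ} (W : Fin r → Submodule R M) : ℕ :=
  {s : Fin r | ¬ Module.Projective R (W s)}.ncard

/-- The multiplicity of `U` as a direct summand of `M`: the largest `m` such that `U ^ m` is
(isomorphic to) a direct summand of `M`, that is, such that there is a split injection
`U ^ m → M`. -/
noncomputable def summandMultiplicity (R U M : Type*) [Ring R] [AddCommMonoid U] [Module R U]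
    [AddCommMonoid M] [Module R M] : ℕ :=
  sSup {m : ℕ | ∃ (f : (Fin m → U) →ₗ[R] M) (g : M →ₗ[R] (Fin m → U)), g ∘ₗ f = LinearMap.id}

/-- The degree of a vertex in a graph with loops: the number of vertices adjacent to `v`,
a loop at `v` contributing `1`. -/
noncomputable def loopDegree {V : Type*} (G : Digraph V) (v : V) : ℕ :=
  {w : V | G.Adj v w}.ncard

namespace SL2Fp

open MvPolynomial

/-! ### The modules `V_n` -/

/-- The substitution `f(X, Y) ↦ f(aX + cY, bX + dY)` attached to the matrix `(a b; c d)`. -/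
noncomputable def subst (k : Type*) [Field k] (m : Matrix (Fin 2) (Fin 2) k) :
    MvPolynomial (Fin 2) k →ₐ[k] MvPolynomial (Fin 2) k :=
  aeval ![C (m 0 0) * X 0 + C (m 1 0) * X 1, C (m 0 1) * X 0 + C (m 1 1) * X 1]

theorem subst_one (k : Type*) [Field k] : subst k 1 = AlgHom.id k _ := by
  ext i
  fin_cases i <;> simp [subst]

theorem subst_mul (k : Type*) [Field k] (m m' : Matrix (Fin 2) (Fin 2) k) :
    subst k (m * m') = (subst k m).comp (subst k m') := by
  refine MvPolynomial.algHom_ext fun i => ?_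
  fin_cases i <;> simp [subst, Matrix.mul_apply, Fin.sum_univ_two] <;> ring

theorem subst_mem (k : Type*) [Field k] (m : Matrix (Fin 2) (Fin 2) k) (d : ℕ)
    {f : MvPolynomial (Fin 2) k} (hf : f ∈ homogeneousSubmodule (Fin 2) k d) :
    subst k m f ∈ homogeneousSubmodule (Fin 2) k d := by
  rw [mem_homogeneousSubmodule] at hf ⊢
  have h := IsHomogeneous.aeval (σ := Fin 2) (τ := Fin 2) (n := 1) hf
    ![C (m 0 0) * X 0 + C (m 1 0) * X 1, C (m 0 1) * X 0 + C (m 1 1) * X 1] (by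
      intro i
      fin_cases i
      · exact ((isHomogeneous_X k 0).C_mul _).add ((isHomogeneous_X k 1).C_mul _)
      · exact ((isHomogeneous_X k 0).C_mul _).add ((isHomogeneous_X k 1).C_mul _))
  rw [one_mul] at h
  exact h

/-- The group `SL₂(𝔽_p)`. -/
abbrev Grp (p : ℕ) : Type := Matrix.SpecialLinearGroup (Fin 2) (ZMod p)

/-- The action of `SL₂(𝔽_p)` on `k[X, Y]`, where the entries of a matrix over `𝔽_p` are viewed in
the field `k` of characteristic `p`: `(a b; c d)` sends `f(X, Y)` to `f(aX + cY, bX + dY)`. -/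
noncomputable def polyRep (p : ℕ) (k : Type*) [Field k] [CharP k p] :
    Representation k (Grp p) (MvPolynomial (Fin 2) k) where
  toFun g := (subst k (g.1.map (ZMod.castHom (dvd_refl p) k))).toLinearMap
  map_one' := by
    rw [Matrix.SpecialLinearGroup.coe_one, Matrix.map_one _ (map_zero _) (map_one _), subst_one]
    rfl
  map_mul' g h := by
    rw [Matrix.SpecialLinearGroup.coe_mul, Matrix.map_mul, subst_mul]
    rfl

/-- For `n ≥ 1`, the `n`-dimensional representation `V_n` of `SL₂(𝔽_p)` on the homogeneous
polynomials of degree `n - 1` in `X` and `Y` (the case `n = 0` is not used). -/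
noncomputable def V (p : ℕ) (k : Type*) [Field k] [CharP k p] (n : ℕ) :
    Representation k (Grp p) (homogeneousSubmodule (Fin 2) k (n - 1)) :=
  Subrepresentation.toRepresentation (ρ := polyRep p k)
    ⟨homogeneousSubmodule (Fin 2) k (n - 1), fun _ _ hf => subst_mem k _ _ hf⟩

/-- `V_n` as a module over the group algebra `k SL₂(𝔽_p)`. -/
abbrev VMod (p : ℕ) (k : Type*) [Field k] [CharP k p] (n : ℕ) : Type _ :=
  (V p k n).asModule

/-- `V_i ⊗ V_n` (over `k`, with diagonal group action) as a module over the group algebra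
`k SL₂(𝔽_p)`. -/
abbrev TensorMod (p : ℕ) (k : Type*) [Field k] [CharP k p] (i n : ℕ) : Type _ :=
  ((V p k i).tprod (V p k n)).asModule

/-! ### The matrix `A^{(n)}` and the graph `𝒢^{(n)}` -/

/-- The index set `{1, …, p - 1}`. -/
abbrev Vertex (p : ℕ) : Type := ↥(Finset.Icc 1 (p - 1))

/-- The matrix whose `(i, j)` entry is the multiplicity of `V_j` as a summand of `V_i ⊗ V_n`. -/
noncomputable def A (p : ℕ) (k : Type*) [Field k] [CharP k p] (n : ℕ) :
    Matrix (Vertex p) (Vertex p) ℕ := fun i j =>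
  summandMultiplicity (MonoidAlgebra k (Grp p)) (VMod p k j) (TensorMod p k i n)

/-- The graph (with loops) with adjacency matrix `A^{(n)}`: there is an edge from `i` to `j` when
the `(i, j)` entry is nonzero. -/
noncomputable def graph (p : ℕ) (k : Type*) [Field k] [CharP k p] (n : ℕ) :
    Digraph (Vertex p) where
  Adj i j := A p k n i j ≠ 0

end SL2Fp

/-! The argument takes place modulo relative traces, the maps `∑ g⁻¹ φ g` with `φ` merely
`k`-linear. They form a two-sided ideal, and by Higman's criterion a module is projective exactly
when its identity is a relative trace (`projective_iff_id_mem_traceHom`). For `j < p` the module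
`V_j` has only scalar endomorphisms and dimension prime to `p`, whereas a relative trace has trace
`|G| tr φ = 0`. So no nonzero endomorphism of `V_j` is a relative trace, and modulo the ideal `V_1,
…, V_{p-1}` behave like pairwise non-isomorphic simple objects. Multiplicities then become ranks of
scalar matrices (`IsSplitFamily.le_of_split`), which is all the Krull–Schmidt theory required.

The tensor products are found by recursion on `n`. Gradient, multiplication by the variables, and
their rotated versions split `V_m ⊗ V_2` as `V_{m+1} ⊕ V_{m-1}` for `2 ≤ m < p`, since `m` is
invertible in `k`. The top case `V_p`, the Steinberg module, is projective by an explicit trace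
formula, so it disappears from the count. Hence the multiplicities in `V_i ⊗ V_n` obey a three-term
recurrence on the path `1, …, p - 1`. Its solution is the truncated Clebsch–Gordan rule: `V_j`
occurs once if `i + n + j` is odd, `|i - n| < j < i + n` and `i + n + j < 2p`, and otherwise not at
all (`hasSplitType_tprod`). This rule is symmetric in `i`, `n`, `j`, and counting the admissible `j`
gives the degree and the sum of the degrees. -/

/-! ### Relative traces and Higman's criterion -/

section RelativeTrace

open MonoidAlgebra

variable (k : Type*) [Field k] {G : Type*} [Group G] [Fintype G]
variable {M : Type*} [AddCommGroup M] [Module k M] [Module (MonoidAlgebra k G) M]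
  [IsScalarTower k (MonoidAlgebra k G) M]
variable {N : Type*} [AddCommGroup N] [Module k N] [Module (MonoidAlgebra k G) N]
  [IsScalarTower k (MonoidAlgebra k G) N]
variable {L : Type*} [AddCommGroup L] [Module k L] [Module (MonoidAlgebra k G) L]
  [IsScalarTower k (MonoidAlgebra k G) L]

/-- The group of module homomorphisms of the form `∑ g, g⁻¹ φ g` with `φ` a `k`-linear map. -/
def traceHom (M N : Type*) [AddCommGroup M] [Module k M] [Module (MonoidAlgebra k G) M]
    [IsScalarTower k (MonoidAlgebra k G) M] [AddCommGroup N] [Module k N]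
    [Module (MonoidAlgebra k G) N] [IsScalarTower k (MonoidAlgebra k G) N] :
    AddSubgroup (M →ₗ[MonoidAlgebra k G] N) where
  carrier := {e | ∃ φ : M →ₗ[k] N, φ.sumOfConjugatesEquivariant G = e}
  zero_mem' := ⟨0, by
    ext v; simp [LinearMap.sumOfConjugatesEquivariant_apply, LinearMap.conjugate_apply]⟩
  add_mem' := by
    rintro _ _ ⟨φ, rfl⟩ ⟨ψ, rfl⟩
    refine ⟨φ + ψ, ?_⟩
    ext v
    simp [LinearMap.sumOfConjugatesEquivariant_apply, LinearMap.conjugate_apply,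
      Finset.sum_add_distrib]
  neg_mem' := by
    rintro _ ⟨φ, rfl⟩
    refine ⟨-φ, ?_⟩
    ext v
    simp [LinearMap.sumOfConjugatesEquivariant_apply, LinearMap.conjugate_apply]

variable {k}

theorem mem_traceHom_iff {e : M →ₗ[MonoidAlgebra k G] N} :
    e ∈ traceHom k M N ↔ ∃ φ : M →ₗ[k] N, ∀ v,
      ∑ g : G, single g⁻¹ (1 : k) • φ (single g (1 : k) • v) = e v := by
  refine exists_congr fun φ => ?_
  rw [LinearMap.ext_iff]
  simp [LinearMap.sumOfConjugatesEquivariant_apply, LinearMap.conjugate_apply]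

theorem comp_mem_traceHom_left {e : M →ₗ[MonoidAlgebra k G] N} (he : e ∈ traceHom k M N)
    (f : N →ₗ[MonoidAlgebra k G] L) : f ∘ₗ e ∈ traceHom k M L := by
  rw [mem_traceHom_iff] at he ⊢
  obtain ⟨φ, hφ⟩ := he
  refine ⟨f.restrictScalars k ∘ₗ φ, fun v => ?_⟩
  simp [← hφ]

theorem comp_mem_traceHom_right {e : M →ₗ[MonoidAlgebra k G] N} (he : e ∈ traceHom k M N)
    (f : L →ₗ[MonoidAlgebra k G] M) : e ∘ₗ f ∈ traceHom k L N := by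
  rw [mem_traceHom_iff] at he ⊢
  obtain ⟨φ, hφ⟩ := he
  refine ⟨φ ∘ₗ f.restrictScalars k, fun v => ?_⟩
  simp [← hφ]

/-- Higman's criterion. Given a section of the free cover, `φ` takes coefficients at the identity of
`G`; conversely, averaging `t ∘ φ`, with `t` a `k`-linear section of the free cover, makes it
equivariant. -/
theorem projective_iff_id_mem_traceHom :
    Module.Projective (MonoidAlgebra k G) M ↔
      (LinearMap.id : M →ₗ[MonoidAlgebra k G] M) ∈ traceHom k M M := by
  classical
  rw [mem_traceHom_iff]
  constructor
  · rintro ⟨s, hs⟩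
    refine ⟨{ toFun := fun m => (s m).sum fun x r => r.coeff 1 • x, map_add' := ?_, map_smul' := ?_ }, ?_⟩
    · intro x y
      rw [map_add, Finsupp.sum_add_index' (by simp) (by intro a b c; simp [add_smul])]
    · intro c x
      have h : s (c • x) = c • s x := (s.restrictScalars k).map_smul c x
      rw [h, Finsupp.sum_of_support_subset (s := (s x).support) _ Finsupp.support_smul _ (by simp),
        Finsupp.sum, RingHom.id_apply, Finset.smul_sum]
      exact Finset.sum_congr rfl fun a _ => by simp [mul_smul]
    · intro v
      simp only [LinearMap.coe_mk, AddHom.coe_mk, map_smul, LinearMap.id_apply]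
      -- The coefficient of `g r` at `1` is that of `r` at `g⁻¹`, so the sum reassembles `r`.
      have key : ∀ r : MonoidAlgebra k G, ∀ x : M,
          ∑ g : G, single g⁻¹ (1 : k) • ((single g (1 : k) * r : MonoidAlgebra k G).coeff 1) • x
            = r • x := by
        intro r x
        have : ∀ g : G, single g⁻¹ (1 : k) • ((single g (1 : k) * r : MonoidAlgebra k G).coeff 1) • x
            = (single g⁻¹ (r.coeff g⁻¹) : MonoidAlgebra k G) • x := by
          intro g
          rw [MonoidAlgebra.coeff_single_mul_apply, one_mul, mul_one, smul_comm, ← smul_assoc]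
          simp
        rw [Finset.sum_congr rfl fun g _ => this g, ← Finset.sum_smul]
        congr 1
        rw [← Equiv.sum_comp (Equiv.inv G)]
        simp only [Equiv.inv_apply, inv_inv]
        conv_rhs => rw [← MonoidAlgebra.sum_coeff_single r]
        exact (Finsupp.sum_fintype _ _ (by simp)).symm
      have h2 : ∀ g : G, ((single g (1 : k) : MonoidAlgebra k G) • s v).sum
          (fun x r => (r.coeff 1 : k) • x) = ∑ x ∈ (s v).support,
            ((single g (1 : k) * s v x : MonoidAlgebra k G).coeff 1) • x := by
        intro g
        rw [Finsupp.sum_of_support_subset (s := (s v).support) _ Finsupp.support_smul _ (by simp)]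
        rfl
      simp only [h2, Finset.smul_sum]
      rw [Finset.sum_comm]
      simp only [key]
      exact hs v
  · rintro ⟨φ, hφ⟩
    let q : (M →₀ MonoidAlgebra k G) →ₗ[MonoidAlgebra k G] M :=
      Finsupp.linearCombination (MonoidAlgebra k G) id
    have hq : Function.Surjective (q.restrictScalars k) := fun m => ⟨Finsupp.single m 1, by simp [q]⟩
    obtain ⟨t, ht⟩ := (q.restrictScalars k).exists_rightInverse_of_surjective
      (LinearMap.range_eq_top.2 hq)
    refine Module.Projective.of_split ((t ∘ₗ φ).sumOfConjugatesEquivariant G) q ?_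
    ext v
    have ht' : ∀ v, q (t v) = v := fun v => LinearMap.congr_fun ht v
    simp [LinearMap.sumOfConjugatesEquivariant_apply, LinearMap.conjugate_apply, ht', hφ]

/-- All conjugates of `φ` have the same trace, so the total is `|G| tr φ`. -/
theorem trace_eq_zero_of_mem_traceHom [FiniteDimensional k M] (hG : (Fintype.card G : k) = 0)
    {e : M →ₗ[MonoidAlgebra k G] M} (he : e ∈ traceHom k M M) :
    LinearMap.trace k M (e.restrictScalars k) = 0 := by
  obtain ⟨φ, rfl⟩ := he
  have h : (φ.sumOfConjugatesEquivariant G).restrictScalars k = ∑ g : G, φ.conjugate g := rfl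
  rw [h, map_sum]
  have h2 : ∀ g : G, LinearMap.trace k M (φ.conjugate g) = LinearMap.trace k M φ := by
    intro g
    rw [LinearMap.conjugate, ← LinearMap.comp_assoc, LinearMap.trace_comp_comm',
      ← LinearMap.comp_assoc]
    congr 1
    ext v
    simp [GroupSMul.linearMap, ← mul_smul, MonoidAlgebra.single_mul_single, ← MonoidAlgebra.one_def]
  simp [h2, hG]

end RelativeTrace

/-! ### Maps factoring through a family of modules -/

section FactorHom

variable {R : Type*} [Ring R] {J : Type*} (S : J → Type*) [∀ j, AddCommGroup (S j)]
  [∀ j, Module R (S j)]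
variable {M : Type*} [AddCommGroup M] [Module R M] {N : Type*} [AddCommGroup N] [Module R N]
  {L : Type*} [AddCommGroup L] [Module R L]

/-- The additive group generated by the homomorphisms that factor through a member of `S`. -/
def factorHom (M N : Type*) [AddCommGroup M] [Module R M] [AddCommGroup N] [Module R N] :
    AddSubgroup (M →ₗ[R] N) :=
  AddSubgroup.closure {e | ∃ (j : J) (f : S j →ₗ[R] N) (g : M →ₗ[R] S j), f ∘ₗ g = e}

variable {S}

theorem comp_mem_factorHom {j : J} (f : S j →ₗ[R] N) (g : M →ₗ[R] S j) :
    f ∘ₗ g ∈ factorHom S M N :=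
  AddSubgroup.subset_closure ⟨j, f, g, rfl⟩

theorem comp_mem_factorHom_left {e : M →ₗ[R] N} (he : e ∈ factorHom S M N) (f : N →ₗ[R] L) :
    f ∘ₗ e ∈ factorHom S M L := by
  induction he using AddSubgroup.closure_induction with
  | mem x hx =>
    obtain ⟨j, a, b, rfl⟩ := hx
    rw [← LinearMap.comp_assoc]
    exact comp_mem_factorHom _ _
  | zero => rw [LinearMap.comp_zero]; exact zero_mem _
  | add x y _ _ hx hy => rw [LinearMap.comp_add]; exact add_mem hx hy
  | neg x _ hx => rw [LinearMap.comp_neg]; exact neg_mem hx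

theorem comp_mem_factorHom_right {e : M →ₗ[R] N} (he : e ∈ factorHom S M N) (f : L →ₗ[R] M) :
    e ∘ₗ f ∈ factorHom S L N := by
  induction he using AddSubgroup.closure_induction with
  | mem x hx =>
    obtain ⟨j, a, b, rfl⟩ := hx
    rw [LinearMap.comp_assoc]
    exact comp_mem_factorHom _ _
  | zero => rw [LinearMap.zero_comp]; exact zero_mem _
  | add x y _ _ hx hy => rw [LinearMap.add_comp]; exact add_mem hx hy
  | neg x _ hx => rw [LinearMap.neg_comp]; exact neg_mem hx

theorem factorHom_comp_factorHom_eq_zero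
    (h : ∀ i j (f : S i →ₗ[R] M) (g : M →ₗ[R] S j), g ∘ₗ f = 0)
    {x y : M →ₗ[R] M} (hx : x ∈ factorHom S M M) (hy : y ∈ factorHom S M M) : x ∘ₗ y = 0 := by
  induction hx using AddSubgroup.closure_induction with
  | mem x hx =>
    obtain ⟨j, a, b, rfl⟩ := hx
    induction hy using AddSubgroup.closure_induction with
    | mem y hy =>
      obtain ⟨j', a', b', rfl⟩ := hy
      rw [LinearMap.comp_assoc, ← LinearMap.comp_assoc b', h, LinearMap.zero_comp,
        LinearMap.comp_zero]
    | zero => rw [LinearMap.comp_zero]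
    | add x y _ _ hx hy => rw [LinearMap.comp_add, hx, hy, add_zero]
    | neg x _ hx => rw [LinearMap.comp_neg, hx, neg_zero]
  | zero => rw [LinearMap.zero_comp]
  | add x y _ _ hx hy => rw [LinearMap.add_comp, hx, hy, add_zero]
  | neg x _ hx => rw [LinearMap.neg_comp, hx, neg_zero]

end FactorHom

/-! ### Splitting modules modulo relative traces -/

section SplitType

set_option linter.unusedSectionVars false

variable {k : Type*} [Field k] {G : Type*} [Group G] [Fintype G]
variable {J : Type*} (S : J → Type*) [∀ j, AddCommGroup (S j)] [∀ j, Module k (S j)]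
  [∀ j, Module (MonoidAlgebra k G) (S j)] [∀ j, IsScalarTower k (MonoidAlgebra k G) (S j)]
variable {M : Type*} [AddCommGroup M] [Module k M] [Module (MonoidAlgebra k G) M]
  [IsScalarTower k (MonoidAlgebra k G) M]
variable {N : Type*} [AddCommGroup N] [Module k N] [Module (MonoidAlgebra k G) N]
  [IsScalarTower k (MonoidAlgebra k G) N]
variable {L : Type*} [AddCommGroup L] [Module k L] [Module (MonoidAlgebra k G) L]
  [IsScalarTower k (MonoidAlgebra k G) L]

variable (k G) in
/-- The identity of `M` is a relative trace from the trivial subgroup. -/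
def IsRelativelyProjective (M : Type*) [AddCommGroup M] [Module k M] [Module (MonoidAlgebra k G) M]
    [IsScalarTower k (MonoidAlgebra k G) M] : Prop :=
  (LinearMap.id : M →ₗ[MonoidAlgebra k G] M) ∈ traceHom k M M

variable (k G) in
/-- The identity of `M` is the sum of a relative trace and of maps that factor through `S`. -/
def IsStablySplit (M : Type*) [AddCommGroup M] [Module k M] [Module (MonoidAlgebra k G) M]
    [IsScalarTower k (MonoidAlgebra k G) M] : Prop :=
  (LinearMap.id : M →ₗ[MonoidAlgebra k G] M) ∈ traceHom k M M ⊔ factorHom S M M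

variable (k G) in
/-- A family of pairwise inequivalent `k[G]`-modules, with only scalar endomorphisms and of
dimension invertible in `k`, where the order of `G` vanishes in `k`. -/
structure IsSplitFamily : Prop where
  card_eq_zero : (Fintype.card G : k) = 0
  finite : ∀ j, FiniteDimensional k (S j)
  finrank_ne_zero : ∀ j, (Module.finrank k (S j) : k) ≠ 0
  end_eq_smul : ∀ j (f : S j →ₗ[MonoidAlgebra k G] S j), ∃ c : k, f = c • LinearMap.id
  hom_eq_zero : ∀ i j, i ≠ j → ∀ f : S i →ₗ[MonoidAlgebra k G] S j, f = 0

variable {S}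

namespace IsSplitFamily

theorem nontrivial (hS : IsSplitFamily k G S) (j : J) : Nontrivial (S j) := by
  by_contra h
  rw [not_nontrivial_iff_subsingleton] at h
  exact hS.finrank_ne_zero j (by rw [Module.finrank_zero_of_subsingleton, Nat.cast_zero])

theorem smul_id_injective (hS : IsSplitFamily k G S) {j : J} {c d : k}
    (h : c • (LinearMap.id : S j →ₗ[MonoidAlgebra k G] S j) = d • LinearMap.id) : c = d := by
  have := hS.nontrivial j
  obtain ⟨v, hv⟩ := exists_ne (0 : S j)
  exact smul_left_injective k hv (by simpa using LinearMap.congr_fun h v)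

/-- A scalar `c` has trace `c dim S_j` with `dim S_j` invertible, while relative traces have trace
zero. -/
theorem eq_zero_of_mem_traceHom (hS : IsSplitFamily k G S) {j : J}
    {e : S j →ₗ[MonoidAlgebra k G] S j} (he : e ∈ traceHom k (S j) (S j)) : e = 0 := by
  have := hS.finite j
  obtain ⟨c, rfl⟩ := hS.end_eq_smul j e
  have h := trace_eq_zero_of_mem_traceHom hS.card_eq_zero he
  have h2 : (c • (LinearMap.id : S j →ₗ[MonoidAlgebra k G] S j)).restrictScalars k
    = c • LinearMap.id := rfl
  rw [h2, map_smul, LinearMap.trace_id, smul_eq_mul, mul_eq_zero] at h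
  rw [h.resolve_right (hS.finrank_ne_zero j), zero_smul]

theorem not_projective (hS : IsSplitFamily k G S) (j : J) :
    ¬ Module.Projective (MonoidAlgebra k G) (S j) := by
  have := hS.nontrivial j
  rw [projective_iff_id_mem_traceHom (k := k)]
  intro h
  obtain ⟨v, hv⟩ := exists_ne (0 : S j)
  exact hv (LinearMap.congr_fun (hS.eq_zero_of_mem_traceHom h) v)

/-- A nonzero composite `S_j → M → S_j` is an invertible scalar and yields a retract after
rescaling. If all such composites vanish, write the identity as `t + y`; then `y² = 0`, that is `(1
- t)² = 0`, so `1 = 2t - t²` lies in the ideal of relative traces. -/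
theorem isRelativelyProjective_or_exists_retract (hS : IsSplitFamily k G S)
    (hM : IsStablySplit k G S M) :
    IsRelativelyProjective k G M ∨ ∃ (j : J) (f : S j →ₗ[MonoidAlgebra k G] M)
      (g : M →ₗ[MonoidAlgebra k G] S j), g ∘ₗ f = LinearMap.id := by
  by_cases h : ∃ (j : J) (f : S j →ₗ[MonoidAlgebra k G] M)
      (g : M →ₗ[MonoidAlgebra k G] S j), g ∘ₗ f ≠ 0
  · obtain ⟨j, f, g, hgf⟩ := h
    obtain ⟨c, hc⟩ := hS.end_eq_smul j (g ∘ₗ f)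
    have hc0 : c ≠ 0 := by
      rintro rfl
      exact hgf (by rw [hc, zero_smul])
    exact .inr ⟨j, f, c⁻¹ • g, by rw [LinearMap.smul_comp, hc, smul_smul, inv_mul_cancel₀ hc0,
      one_smul]⟩
  · left
    push Not at h
    obtain ⟨t, ht, y, hy, hty⟩ := AddSubgroup.mem_sup.1 hM
    have hyy : y ∘ₗ y = 0 := by
      refine factorHom_comp_factorHom_eq_zero (S := S) (fun i j f g => ?_) hy hy
      by_cases hij : i = j
      · subst hij
        exact h _ _ _
      · exact hS.hom_eq_zero _ _ hij _
    have hy' : y = LinearMap.id - t := by rw [← hty]; abel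
    rw [hy'] at hyy
    have : (LinearMap.id : M →ₗ[MonoidAlgebra k G] M) = t + t - t ∘ₗ t := by
      rw [LinearMap.sub_comp, LinearMap.id_comp, LinearMap.comp_sub, LinearMap.comp_id,
        sub_sub, sub_eq_zero] at hyy
      rw [hyy]; abel
    unfold IsRelativelyProjective
    rw [this]
    exact sub_mem (add_mem ht ht) (comp_mem_traceHom_left ht t)

end IsSplitFamily

variable (k G S) in
/-- `M` is the direct sum of members of `S`, the `j`-th occurring `c j` times, and a projective
module. -/
def HasSplitType (M : Type*) [AddCommGroup M] [Module k M] [Module (MonoidAlgebra k G) M]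
    [IsScalarTower k (MonoidAlgebra k G) M] (c : J → ℕ) : Prop :=
  ∃ (T : Type) (_ : Fintype T) (_ : DecidableEq T) (j : T → J)
    (ι : ∀ s, S (j s) →ₗ[MonoidAlgebra k G] M) (π : ∀ s, M →ₗ[MonoidAlgebra k G] S (j s)),
    (∀ s, π s ∘ₗ ι s = LinearMap.id) ∧ (∀ s t, s ≠ t → π s ∘ₗ ι t = 0) ∧
    -- The complement enters only through its idempotent; that this is a relative trace expresses
    -- its projectivity.
    LinearMap.id - ∑ s, ι s ∘ₗ π s ∈ traceHom k M M ∧ ∀ a, c a = Nat.card {s // j s = a}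

namespace HasSplitType

theorem of_isRelativelyProjective (h : IsRelativelyProjective k G M) :
    HasSplitType k G S M 0 :=
  ⟨Empty, inferInstance, inferInstance, Empty.elim, fun s => s.elim, fun s => s.elim,
    fun s => s.elim, fun s => s.elim, by simpa [IsRelativelyProjective] using h, fun a => by simp⟩

theorem single [DecidableEq J] (j : J) : HasSplitType k G S (S j) (Pi.single j 1) := by
  refine ⟨Unit, inferInstance, inferInstance, fun _ => j, fun _ => LinearMap.id,
    fun _ => LinearMap.id, fun _ => rfl, fun s t h => (h rfl).elim, by simp, fun a => ?_⟩
  by_cases h : a = j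
  · subst h; simp
  · have : IsEmpty {s : Unit // j = a} := ⟨fun s => h s.2.symm⟩
    simp [h]

theorem isStablySplit {c : J → ℕ} (h : HasSplitType k G S M c) :
    IsStablySplit k G S M := by
  obtain ⟨T, _, _, j, ι, π, -, -, h, -⟩ := h
  unfold IsStablySplit
  rw [← sub_add_cancel LinearMap.id (∑ s, ι s ∘ₗ π s)]
  exact AddSubgroup.add_mem_sup h (sum_mem fun s _ => comp_mem_factorHom _ _)

/-- The pieces need to exhaust `M` only up to a relative trace. The new defect is the outer one plus
the inner ones carried into `M`, and relative traces are stable under composition on both sides. -/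
theorem glue {T : Type} [Fintype T] [DecidableEq T] (N : T → Type*) [∀ s, AddCommGroup (N s)]
    [∀ s, Module k (N s)] [∀ s, Module (MonoidAlgebra k G) (N s)]
    [∀ s, IsScalarTower k (MonoidAlgebra k G) (N s)]
    (ι : ∀ s, N s →ₗ[MonoidAlgebra k G] M) (π : ∀ s, M →ₗ[MonoidAlgebra k G] N s)
    (hid : ∀ s, π s ∘ₗ ι s = LinearMap.id) (hort : ∀ s t, s ≠ t → π s ∘ₗ ι t = 0)
    (htr : LinearMap.id - ∑ s, ι s ∘ₗ π s ∈ traceHom k M M)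
    {c : T → J → ℕ} (h : ∀ s, HasSplitType k G S (N s) (c s)) :
    HasSplitType k G S M (∑ s, c s) := by
  choose T' _ _ j ι' π' hid' hort' htr' hc using h
  refine ⟨Σ s, T' s, inferInstance, inferInstance, fun x => j x.1 x.2,
    fun x => ι x.1 ∘ₗ ι' x.1 x.2, fun x => π' x.1 x.2 ∘ₗ π x.1, ?_, ?_, ?_, ?_⟩
  · rintro ⟨s, a⟩
    dsimp only
    rw [LinearMap.comp_assoc, ← LinearMap.comp_assoc _ (ι s), hid, LinearMap.id_comp, hid']
  · rintro ⟨s, a⟩ ⟨t, b⟩ hne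
    dsimp only
    rw [LinearMap.comp_assoc, ← LinearMap.comp_assoc _ (ι t)]
    by_cases hst : s = t
    · subst hst
      rw [hid, LinearMap.id_comp]
      exact hort' s a b fun hab => hne (by rw [hab])
    · rw [hort s t hst, LinearMap.zero_comp, LinearMap.comp_zero]
  · rw [Fintype.sum_sigma]
    have : (LinearMap.id : M →ₗ[MonoidAlgebra k G] M) -
        ∑ s, ∑ a, (ι s ∘ₗ ι' s a) ∘ₗ (π' s a ∘ₗ π s) = (LinearMap.id - ∑ s, ι s ∘ₗ π s) +
        ∑ s, ι s ∘ₗ (LinearMap.id - ∑ a, ι' s a ∘ₗ π' s a) ∘ₗ π s := by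
      have h2 : ∀ s, ι s ∘ₗ (LinearMap.id - ∑ a, ι' s a ∘ₗ π' s a) ∘ₗ π s =
          ι s ∘ₗ π s - ∑ a, (ι s ∘ₗ ι' s a) ∘ₗ (π' s a ∘ₗ π s) := by
        intro s
        ext v
        simp
      simp only [h2, Finset.sum_sub_distrib]
      abel
    rw [this]
    exact add_mem htr (sum_mem fun s _ =>
      comp_mem_traceHom_left (comp_mem_traceHom_right (htr' s) _) _)
  · intro a
    rw [Finset.sum_apply, Finset.sum_congr rfl fun s _ => hc s a]
    have e : {x : Σ s, T' s // j x.1 x.2 = a} ≃ Σ s, {y : T' s // j s y = a} :=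
      { toFun := fun x => ⟨x.1.1, x.1.2, x.2⟩
        invFun := fun x => ⟨⟨x.1, x.2.1⟩, x.2.2⟩
        left_inv := fun _ => rfl
        right_inv := fun _ => rfl }
    rw [Nat.card_congr e, Nat.card_sigma]

/-- The analogue of `glue` for an exact decomposition into two summands, which may lie in different
universes. -/
theorem add {c₁ c₂ : J → ℕ} (h₁ : HasSplitType k G S N c₁) (h₂ : HasSplitType k G S L c₂)
    (ι₁ : N →ₗ[MonoidAlgebra k G] M) (π₁ : M →ₗ[MonoidAlgebra k G] N)
    (ι₂ : L →ₗ[MonoidAlgebra k G] M) (π₂ : M →ₗ[MonoidAlgebra k G] L)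
    (h11 : π₁ ∘ₗ ι₁ = LinearMap.id) (h22 : π₂ ∘ₗ ι₂ = LinearMap.id) (h12 : π₁ ∘ₗ ι₂ = 0)
    (h21 : π₂ ∘ₗ ι₁ = 0) (hsum : ι₁ ∘ₗ π₁ + ι₂ ∘ₗ π₂ = LinearMap.id) :
    HasSplitType k G S M (c₁ + c₂) := by
  obtain ⟨T, _, _, j, ι, π, hid, hort, htr, hc⟩ := h₁
  obtain ⟨T', _, _, j', ι', π', hid', hort', htr', hc'⟩ := h₂
  refine ⟨T ⊕ T', inferInstance, inferInstance, Sum.elim j j',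
    Sum.rec (fun s => ι₁ ∘ₗ ι s) (fun s => ι₂ ∘ₗ ι' s),
    Sum.rec (fun s => π s ∘ₗ π₁) (fun s => π' s ∘ₗ π₂), ?_, ?_, ?_, ?_⟩
  · rintro (s | s)
    · change (π s ∘ₗ π₁) ∘ₗ (ι₁ ∘ₗ ι s) = _
      rw [LinearMap.comp_assoc, ← LinearMap.comp_assoc _ ι₁, h11, LinearMap.id_comp, hid]; rfl
    · change (π' s ∘ₗ π₂) ∘ₗ (ι₂ ∘ₗ ι' s) = _
      rw [LinearMap.comp_assoc, ← LinearMap.comp_assoc _ ι₂, h22, LinearMap.id_comp, hid']; rfl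
  · rintro (s | s) (t | t) hne
    · change (π s ∘ₗ π₁) ∘ₗ (ι₁ ∘ₗ ι t) = _
      rw [LinearMap.comp_assoc, ← LinearMap.comp_assoc _ ι₁, h11, LinearMap.id_comp]
      exact hort s t fun h => hne (by rw [h])
    · change (π s ∘ₗ π₁) ∘ₗ (ι₂ ∘ₗ ι' t) = _
      rw [LinearMap.comp_assoc, ← LinearMap.comp_assoc _ ι₂, h12, LinearMap.zero_comp,
        LinearMap.comp_zero]; rfl
    · change (π' s ∘ₗ π₂) ∘ₗ (ι₁ ∘ₗ ι t) = _
      rw [LinearMap.comp_assoc, ← LinearMap.comp_assoc _ ι₁, h21, LinearMap.zero_comp,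
        LinearMap.comp_zero]; rfl
    · change (π' s ∘ₗ π₂) ∘ₗ (ι₂ ∘ₗ ι' t) = _
      rw [LinearMap.comp_assoc, ← LinearMap.comp_assoc _ ι₂, h22, LinearMap.id_comp]
      exact hort' s t fun h => hne (by rw [h])
  · rw [Fintype.sum_sum_type]
    change (LinearMap.id : M →ₗ[MonoidAlgebra k G] M) -
        (∑ s, (ι₁ ∘ₗ ι s) ∘ₗ (π s ∘ₗ π₁) + ∑ s, (ι₂ ∘ₗ ι' s) ∘ₗ (π' s ∘ₗ π₂)) ∈ _
    have : (LinearMap.id : M →ₗ[MonoidAlgebra k G] M) -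
        (∑ s, (ι₁ ∘ₗ ι s) ∘ₗ (π s ∘ₗ π₁) + ∑ s, (ι₂ ∘ₗ ι' s) ∘ₗ (π' s ∘ₗ π₂)) =
        ι₁ ∘ₗ (LinearMap.id - ∑ s, ι s ∘ₗ π s) ∘ₗ π₁ +
        ι₂ ∘ₗ (LinearMap.id - ∑ s, ι' s ∘ₗ π' s) ∘ₗ π₂ := by
      rw [← hsum]
      ext v
      simp
      abel
    rw [this]
    exact add_mem (comp_mem_traceHom_left (comp_mem_traceHom_right htr _) _)
      (comp_mem_traceHom_left (comp_mem_traceHom_right htr' _) _)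
  · intro a
    rw [Pi.add_apply, hc, hc', ← Nat.card_sum]
    exact Nat.card_congr (Equiv.subtypeSum (p := fun x => Sum.elim j j' x = a)).symm

theorem congr {c : J → ℕ} (h : HasSplitType k G S N c) (e : N ≃ₗ[MonoidAlgebra k G] M) :
    HasSplitType k G S M c := by
  have := glue (T := Unit) (fun _ => N) (fun _ => e.toLinearMap) (fun _ => e.symm.toLinearMap)
    (fun _ => by ext; simp) (fun s t h => (h rfl).elim) (by
      have : e.toLinearMap ∘ₗ e.symm.toLinearMap = LinearMap.id := by ext; simp
      simp [this]) (fun _ => h)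
  simpa using this

end HasSplitType

/-- Being a sum of a relative trace and of maps through `S` passes to direct summands. -/
theorem IsStablySplit.of_retract (hM : IsStablySplit k G S M)
    (f : N →ₗ[MonoidAlgebra k G] M) (g : M →ₗ[MonoidAlgebra k G] N) (hgf : g ∘ₗ f = LinearMap.id) :
    IsStablySplit k G S N := by
  obtain ⟨t, ht, y, hy, hty⟩ := AddSubgroup.mem_sup.1 hM
  have : (LinearMap.id : N →ₗ[MonoidAlgebra k G] N) = g ∘ₗ t ∘ₗ f + g ∘ₗ y ∘ₗ f := by
    rw [← LinearMap.comp_add, ← LinearMap.add_comp, hty, LinearMap.id_comp, hgf]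
  unfold IsStablySplit
  rw [this]
  exact AddSubgroup.add_mem_sup (comp_mem_traceHom_left (comp_mem_traceHom_right ht f) g)
    (comp_mem_factorHom_left (comp_mem_factorHom_right hy f) g)

namespace IsSplitFamily

/-- Induction on dimension: as long as `M` is not projective, a member of `S` splits off, and the
complement `ker g`, being a retract, is stably split again. -/
theorem exists_hasSplitType [DecidableEq J] (hS : IsSplitFamily k G S) [FiniteDimensional k M]
    (hM : IsStablySplit k G S M) :
    ∃ c, HasSplitType k G S M c := by
  obtain ⟨d, hd⟩ : ∃ d, Module.finrank k M = d := ⟨_, rfl⟩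
  induction d using Nat.strong_induction_on generalizing M with
  | _ d ih =>
  rcases hS.isRelativelyProjective_or_exists_retract hM with h | ⟨j, f, g, hgf⟩
  · exact ⟨0, .of_isRelativelyProjective h⟩
  · have hgf' : ∀ v, g (f v) = v := fun v => LinearMap.congr_fun hgf v
    let K := LinearMap.ker g
    let q : M →ₗ[MonoidAlgebra k G] K := (LinearMap.id - f ∘ₗ g).codRestrict K fun v => by
      simp [K, hgf']
    have hq : q ∘ₗ K.subtype = LinearMap.id := by
      ext ⟨v, hv⟩
      have hv : g v = 0 := hv
      simp [q, hv]
    have hfin : FiniteDimensional k K :=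
      FiniteDimensional.of_injective (K.subtype.restrictScalars k) K.injective_subtype
    have hlt : Module.finrank k K < d := by
      rw [← hd]
      have := hS.nontrivial j
      obtain ⟨w, hw⟩ := exists_ne (0 : S j)
      have h1 : Module.finrank k (LinearMap.ker (g.restrictScalars k)) < Module.finrank k M := by
        refine Submodule.finrank_lt fun h => hw ?_
        have : f w ∈ LinearMap.ker (g.restrictScalars k) := by rw [h]; trivial
        rw [← hgf' w]
        exact this
      exact h1
    obtain ⟨c, hc⟩ := ih _ hlt (IsStablySplit.of_retract hM K.subtype q hq) rfl
    refine ⟨Pi.single j 1 + c, (HasSplitType.single j).add hc f g K.subtype q hgf hq ?_ ?_ ?_⟩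
    · ext ⟨v, hv⟩; exact hv
    · ext v; simp [q, hgf']
    · ext v; simp [q]

theorem projective_or_equiv_of_indecomposable (hS : IsSplitFamily k G S)
    (hM : IsStablySplit k G S M)
    (hind : IsIndecomposableModule (MonoidAlgebra k G) M) :
    IsRelativelyProjective k G M ∨ ∃ j, Nonempty (S j ≃ₗ[MonoidAlgebra k G] M) := by
  refine (hS.isRelativelyProjective_or_exists_retract hM).imp_right ?_
  rintro ⟨j, f, g, hgf⟩
  have hgf' : ∀ v, g (f v) = v := fun v => LinearMap.congr_fun hgf v
  have hinj : Function.Injective f := Function.LeftInverse.injective hgf'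
  refine ⟨j, ⟨LinearEquiv.ofBijective f ⟨hinj, ?_⟩⟩⟩
  have hcompl : IsCompl (LinearMap.range f) (LinearMap.ker g) := by
    refine ⟨Submodule.disjoint_def.2 ?_, codisjoint_iff.2 (eq_top_iff.2 fun v _ => ?_)⟩
    · rintro _ ⟨w, rfl⟩ hw
      rw [LinearMap.mem_ker, hgf'] at hw
      rw [hw, map_zero]
    · exact Submodule.mem_sup.2 ⟨f (g v), ⟨g v, rfl⟩, v - f (g v), by simp [hgf'], by abel⟩
  rcases hind.2 _ _ hcompl with h | h
  · have := hS.nontrivial j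
    obtain ⟨w, hw⟩ := exists_ne (0 : S j)
    rw [LinearMap.range_eq_bot] at h
    exact (hw (by rw [← hgf' w, h, LinearMap.zero_apply, map_zero])).elim
  · rw [h] at hcompl
    exact LinearMap.range_eq_top.1 (by simpa using hcompl.sup_eq_top)

end IsSplitFamily

end SplitType

/-! ### Multiplicities and uniqueness -/

section Multiplicity

set_option linter.unusedSectionVars false

variable {k : Type*} [Field k] {G : Type*} [Group G] [Fintype G]
variable {J : Type*} {S : J → Type*} [∀ j, AddCommGroup (S j)] [∀ j, Module k (S j)]
  [∀ j, Module (MonoidAlgebra k G) (S j)] [∀ j, IsScalarTower k (MonoidAlgebra k G) (S j)]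
variable {M : Type*} [AddCommGroup M] [Module k M] [Module (MonoidAlgebra k G) M]
  [IsScalarTower k (MonoidAlgebra k G) M]

theorem HasSplitType.exists_split {c : J → ℕ} (h : HasSplitType k G S M c) (a : J) :
    ∃ (f : (Fin (c a) → S a) →ₗ[MonoidAlgebra k G] M)
      (g : M →ₗ[MonoidAlgebra k G] (Fin (c a) → S a)), g ∘ₗ f = LinearMap.id := by
  classical
  obtain ⟨T, _, _, j, ι, π, hid, hort, -, hc⟩ := h
  have hcard : Fintype.card {s // j s = a} = c a := by rw [hc, Nat.card_eq_fintype_card]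
  let e : Fin (c a) ≃ {s // j s = a} := (Fintype.equivFinOfCardEq hcard).symm
  -- Transport along `j s = a`, since the two modules are not definitionally equal.
  let u : ∀ s : {s // j s = a}, S (j s) ≃ₗ[MonoidAlgebra k G] S a := fun s =>
    Eq.rec (motive := fun b _ => S (j s) ≃ₗ[MonoidAlgebra k G] S b) (LinearEquiv.refl _ _) s.2
  refine ⟨∑ x, (ι (e x) ∘ₗ (u (e x)).symm.toLinearMap) ∘ₗ LinearMap.proj x,
    LinearMap.pi fun x => (u (e x)).toLinearMap ∘ₗ π (e x), ?_⟩
  refine LinearMap.ext fun v => funext fun x => ?_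
  have h1 : ∀ s v, π s (ι s v) = v := fun s v => LinearMap.congr_fun (hid s) v
  have h2 : ∀ s t, s ≠ t → ∀ v, π s (ι t v) = 0 := fun s t hst v =>
    LinearMap.congr_fun (hort s t hst) v
  simp only [LinearMap.comp_apply, LinearMap.pi_apply, LinearMap.sum_apply, map_sum,
    LinearMap.proj_apply, LinearMap.id_apply, LinearEquiv.coe_coe]
  rw [Finset.sum_eq_single x]
  · rw [h1, LinearEquiv.apply_symm_apply]
  · intro y _ hy
    rw [h2 _ _ (fun h => hy (e.injective (Subtype.ext h)).symm), map_zero]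
  · simp

/-- Modulo relative traces, which vanish on `S a`, the identity of `S a ^ m` factors through the
listed summands of `M`. All components are scalars, and only the `c a` summands labelled `a`
contribute. So the identity matrix of size `m` factors as `B * C` through size `c a`, and rank gives
the bound. -/
theorem IsSplitFamily.le_of_split (hS : IsSplitFamily k G S) {c : J → ℕ}
    (h : HasSplitType k G S M c) {a : J} {m : ℕ}
    (f : (Fin m → S a) →ₗ[MonoidAlgebra k G] M)
    (g : M →ₗ[MonoidAlgebra k G] (Fin m → S a)) (hgf : g ∘ₗ f = LinearMap.id) : m ≤ c a := by
  classical
  obtain ⟨T, _, _, j, ι, π, -, -, htr, hc⟩ := h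
  let f' : Fin m → S a →ₗ[MonoidAlgebra k G] M := fun x => f ∘ₗ LinearMap.single (MonoidAlgebra k G) (fun _ => S a) x
  let g' : Fin m → M →ₗ[MonoidAlgebra k G] S a := fun x => LinearMap.proj x ∘ₗ g
  have hgf' : ∀ x y, g' x ∘ₗ f' y = ((1 : Matrix (Fin m) (Fin m) k) x y) • LinearMap.id := by
    intro x y
    ext v
    have : g (f (Pi.single y v)) = Pi.single y v := LinearMap.congr_fun hgf _
    by_cases hxy : x = y
    · subst hxy; simp [f', g', this]
    · simp [f', g', this, hxy]
  have key : ∀ s, ∃ β γ : Fin m → k, (∀ x y, (g' x ∘ₗ ι s) ∘ₗ (π s ∘ₗ f' y) =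
      (β x * γ y) • LinearMap.id) ∧ (j s ≠ a → β = 0) := by
    intro s
    by_cases hs : j s = a
    · subst hs
      choose β hβ using fun x => hS.end_eq_smul _ (g' x ∘ₗ ι s)
      choose γ hγ using fun y => hS.end_eq_smul _ (π s ∘ₗ f' y)
      refine ⟨β, γ, fun x y => ?_, fun h => (h rfl).elim⟩
      rw [hβ, hγ, LinearMap.smul_comp, LinearMap.id_comp, smul_smul]
    · refine ⟨0, 0, fun x y => ?_, fun _ => rfl⟩
      rw [hS.hom_eq_zero _ _ hs (g' x ∘ₗ ι s)]
      simp
  choose β γ hβγ hβ using key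
  let B : Matrix (Fin m) {s // j s = a} k := fun x s => β s x
  let C : Matrix {s // j s = a} (Fin m) k := fun s y => γ s y
  have hBC : (1 : Matrix (Fin m) (Fin m) k) = B * C := by
    ext x y
    apply hS.smul_id_injective (j := a)
    rw [← hgf']
    -- The projective complement of `M` contributes only relative traces on `S a`, hence nothing.
    have hz : g' x ∘ₗ (LinearMap.id - ∑ s, ι s ∘ₗ π s) ∘ₗ f' y = 0 :=
      hS.eq_zero_of_mem_traceHom (comp_mem_traceHom_left (comp_mem_traceHom_right htr _) _)
    have hexp : g' x ∘ₗ (LinearMap.id - ∑ s, ι s ∘ₗ π s) ∘ₗ f' y =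
        g' x ∘ₗ f' y - ∑ s, (g' x ∘ₗ ι s) ∘ₗ (π s ∘ₗ f' y) := by
      ext v
      simp
    rw [hexp, sub_eq_zero] at hz
    rw [hz, Finset.sum_congr rfl fun s _ => hβγ s x y, ← Finset.sum_smul]
    congr 1
    rw [Matrix.mul_apply, ← Finset.sum_subtype (Finset.univ.filter (j · = a)) (by simp)
      (fun s => β s x * γ s y)]
    refine (Finset.sum_filter_of_ne fun s _ h => ?_).symm
    by_contra hs
    exact h (by rw [hβ s hs, Pi.zero_apply, zero_mul])
  have h1 : (1 : Matrix (Fin m) (Fin m) k).rank ≤ B.rank := by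
    rw [hBC]; exact Matrix.rank_mul_le_left _ _
  rw [Matrix.rank_one, Fintype.card_fin] at h1
  rw [hc, Nat.card_eq_fintype_card]
  exact h1.trans (Matrix.rank_le_card_width B)

theorem IsSplitFamily.summandMultiplicity_eq (hS : IsSplitFamily k G S) {c : J → ℕ}
    (h : HasSplitType k G S M c) (a : J) :
    summandMultiplicity (MonoidAlgebra k G) (S a) M = c a :=
  IsGreatest.csSup_eq ⟨h.exists_split a, fun _ ⟨f, g, hgf⟩ => hS.le_of_split h f g hgf⟩

/-- The form of Krull–Schmidt used here: both types equal the intrinsic multiplicities. -/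
theorem IsSplitFamily.hasSplitType_unique (hS : IsSplitFamily k G S) {c c' : J → ℕ}
    (h : HasSplitType k G S M c) (h' : HasSplitType k G S M c') : c = c' :=
  funext fun a => by rw [← hS.summandMultiplicity_eq h, hS.summandMultiplicity_eq h']

theorem numNonProjective_eq_sum [Fintype J] (hS : IsSplitFamily k G S)
    {c : J → ℕ} (h : HasSplitType k G S M c) {r : ℕ}
    (W : Fin r → Submodule (MonoidAlgebra k G) M) (hW : IsIndecomposableDecomposition W) :
    numNonProjective W = ∑ a, c a := by
  classical
  obtain ⟨hint, hind⟩ := hW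
  let e := LinearEquiv.ofBijective (DirectSum.coeLinearMap W) hint
  let π : ∀ s, M →ₗ[MonoidAlgebra k G] W s := fun s =>
    DirectSum.component _ _ _ s ∘ₗ e.symm.toLinearMap
  have he : ∀ s (v : W s), e.symm v = DirectSum.lof (MonoidAlgebra k G) _ (fun s => W s) s v := by
    intro s v
    rw [LinearEquiv.symm_apply_eq]
    exact (DirectSum.coeLinearMap_lof W s v).symm
  have hid : ∀ s, π s ∘ₗ (W s).subtype = LinearMap.id := by
    intro s
    refine LinearMap.ext fun v => ?_
    simp [π, he]
  have hort : ∀ s t, s ≠ t → π s ∘ₗ (W t).subtype = 0 := by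
    intro s t hst
    refine LinearMap.ext fun v => ?_
    simp only [π, LinearMap.comp_apply, LinearEquiv.coe_coe, Submodule.subtype_apply, he]
    rw [DirectSum.lof_eq_of]
    exact DirectSum.of_eq_of_ne _ _ _ hst
  have hsum : ∑ s, (W s).subtype ∘ₗ π s = LinearMap.id := by
    refine LinearMap.ext fun v => ?_
    obtain ⟨x, rfl⟩ := e.surjective v
    simp only [π, LinearMap.sum_apply, LinearMap.comp_apply, LinearEquiv.coe_coe,
      LinearEquiv.symm_apply_apply, Submodule.subtype_apply, LinearMap.id_apply]
    refine Eq.trans ?_ (DirectSum.coeLinearMap_eq_dfinsuppSum W x).symm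
    exact (DFinsupp.sum_eq_sum_fintype x (by simp)).symm
  -- As a retract of `M`, each summand is stably split; being indecomposable, it is either
  -- projective, of type zero, or a single member of `S`, of type with total one.
  have hc : ∀ s, ∃ c : J → ℕ, HasSplitType k G S (W s) c ∧
      ∑ a, c a = if Module.Projective (MonoidAlgebra k G) (W s) then 0 else 1 := by
    intro s
    rcases hS.projective_or_equiv_of_indecomposable
      (h.isStablySplit.of_retract _ _ (hid s)) (hind s) with hp | ⟨j, ⟨u⟩⟩
    · refine ⟨0, .of_isRelativelyProjective hp, ?_⟩
      rw [if_pos (projective_iff_id_mem_traceHom.2 hp)]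
      simp
    · refine ⟨Pi.single j 1, (HasSplitType.single j).congr u, ?_⟩
      rw [if_neg fun hp : Module.Projective _ _ => hS.not_projective j (.of_equiv u.symm)]
      simp
  choose c' hc' hc'' using hc
  have hglue := HasSplitType.glue (fun s => W s) (fun s => (W s).subtype) π hid hort
    (by rw [hsum, sub_self]; exact zero_mem _) hc'
  rw [hS.hasSplitType_unique h hglue]
  simp only [Finset.sum_apply]
  rw [Finset.sum_comm, Finset.sum_congr rfl fun s _ => hc'' s, numNonProjective,
    Set.ncard_eq_toFinset_card']
  simp [Finset.sum_ite, Finset.filter_not]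

end Multiplicity

/-! ### Existence of indecomposable decompositions -/

theorem exists_isIndecomposableDecomposition (k : Type*) [Field k] {R : Type*} [Ring R] [Algebra k R]
    (M : Type*) [AddCommGroup M] [Module k M] [Module R M] [IsScalarTower k R M]
    [FiniteDimensional k M] :
    ∃ (r : ℕ) (W : Fin r → Submodule R M), IsIndecomposableDecomposition W := by
  classical
  -- Indecomposables are nonzero, so independent ones are distinct and a finite set records them
  -- without loss.
  have key : ∀ d, ∀ N : Submodule R M, Module.finrank k N = d → ∃ s : Finset (Submodule R M),
      s.SupIndep id ∧ s.sup id = N ∧ ∀ W ∈ s, IsIndecomposableModule R W := by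
    intro d
    induction d using Nat.strong_induction_on with
    | _ d ih =>
    intro N hN
    by_cases hbot : N = ⊥
    · exact ⟨∅, by simp, by simp [hbot], by simp⟩
    by_cases hind : IsIndecomposableModule R N
    · exact ⟨{N}, by simp, by simp, by simpa using hind⟩
    have hnt : Nontrivial N := Submodule.nontrivial_iff_ne_bot.2 hbot
    simp only [IsIndecomposableModule, hnt, true_and, not_forall, not_or] at hind
    obtain ⟨N₁, N₂, hc, h1, h2⟩ := hind
    have hlt : ∀ N₁ N₂ : Submodule R N, IsCompl N₁ N₂ → N₂ ≠ ⊥ →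
        Module.finrank k (N₁.map N.subtype) < d := by
      intro N₁ N₂ hc h2
      have hne : N₁ ≠ ⊤ := fun h => h2 (by rw [h] at hc; exact eq_bot_of_top_isCompl hc)
      have hlt : N₁.map N.subtype < N := by
        refine lt_of_le_of_ne (Submodule.map_subtype_le _ _) fun h => hne ?_
        exact Submodule.map_injective_of_injective N.injective_subtype
          (h.trans (Submodule.map_subtype_top N).symm)
      rw [← hN]
      exact Submodule.finrank_lt_finrank_of_lt (s := (N₁.map N.subtype).restrictScalars k)
        (t := N.restrictScalars k) hlt
    obtain ⟨s₁, hs₁, hsup₁, hi₁⟩ := ih _ (hlt N₁ N₂ hc h2) _ rfl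
    obtain ⟨s₂, hs₂, hsup₂, hi₂⟩ := ih _ (hlt N₂ N₁ hc.symm h1) _ rfl
    refine ⟨s₁ ∪ s₂, hs₁.union hs₂ ?_, ?_, ?_⟩
    · rw [hsup₁, hsup₂]
      exact Submodule.disjoint_map N.injective_subtype hc.disjoint
    · rw [Finset.sup_union, hsup₁, hsup₂, ← Submodule.map_sup, hc.sup_eq_top,
        Submodule.map_subtype_top]
    · intro W hW
      rcases Finset.mem_union.1 hW with h | h
      exacts [hi₁ W h, hi₂ W h]
  obtain ⟨s, hs, hsup, hi⟩ := key _ ⊤ rfl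
  refine ⟨s.card, fun x => (s.equivFin.symm x : Submodule R M), ?_, fun x => hi _ (s.equivFin.symm x).2⟩
  rw [DirectSum.isInternal_submodule_iff_iSupIndep_and_iSup_eq_top]
  constructor
  · have : iSupIndep fun x : s => (x : Submodule R M) := by
      exact hs.independent
    exact this.comp s.equivFin.symm.injective
  · rw [Equiv.iSup_comp (g := fun x : s => (x : Submodule R M)) s.equivFin.symm, ← hsup,
      Finset.sup_eq_iSup, iSup_subtype]
    rfl

/-! ### Equivariant maps and tensoring on the left -/

namespace Representation

open MonoidAlgebra

variable {k G V W U : Type*} [Field k] [Group G] [AddCommGroup V] [Module k V] [AddCommGroup W]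
  [Module k W] [AddCommGroup U] [Module k U]
  {ρ : Representation k G V} {σ : Representation k G W} {τ : Representation k G U}

/-- An equivariant linear map, as a homomorphism of modules over the group algebra. -/
noncomputable def toModuleHom (f : V →ₗ[k] W) (hf : ∀ g v, f (ρ g v) = σ g (f v)) :
    ρ.asModule →ₗ[MonoidAlgebra k G] σ.asModule :=
  IntertwiningMap.equivLinearMapAsModule ρ σ (f.intertwiningMap_of_isIntertwiningMap ρ σ hf)

/-- The linear map underlying a homomorphism of modules over the group algebra. -/
noncomputable def ofModuleHom (f : ρ.asModule →ₗ[MonoidAlgebra k G] σ.asModule) : V →ₗ[k] W :=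
  ((IntertwiningMap.equivLinearMapAsModule ρ σ).symm f).toLinearMap

theorem ofModuleHom_rho (f : ρ.asModule →ₗ[MonoidAlgebra k G] σ.asModule) (g : G) (v : V) :
    ofModuleHom f (ρ g v) = σ g (ofModuleHom f v) :=
  ((IntertwiningMap.equivLinearMapAsModule ρ σ).symm f).isIntertwining _ _ g v

theorem moduleHom_ext {f f' : ρ.asModule →ₗ[MonoidAlgebra k G] σ.asModule}
    (h : ∀ v, ofModuleHom f v = ofModuleHom f' v) : f = f' :=
  LinearMap.ext h

theorem mem_traceHom_asModule_iff [Fintype G]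
    {e : ρ.asModule →ₗ[MonoidAlgebra k G] σ.asModule} :
    e ∈ traceHom k ρ.asModule σ.asModule ↔ ∃ φ : V →ₗ[k] W, ∀ v,
      ∑ g : G, σ g⁻¹ (φ (ρ g v)) = ofModuleHom e v := by
  rw [mem_traceHom_iff]
  have hs : ∀ (g : G) (v : ρ.asModule), single g (1 : k) • v = ρ g v := by
    intro g v
    rw [single_smul, one_smul]; rfl
  have hs' : ∀ (g : G) (v : σ.asModule), single g (1 : k) • v = σ g v := by
    intro g v
    rw [single_smul, one_smul]; rfl
  simp only [hs, hs']
  rfl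

/-- Tensoring on the left with a representation, on homomorphisms. -/
noncomputable def lTensorHom (τ : Representation k G U)
    (f : ρ.asModule →ₗ[MonoidAlgebra k G] σ.asModule) :
    (τ.tprod ρ).asModule →ₗ[MonoidAlgebra k G] (τ.tprod σ).asModule :=
  toModuleHom ((ofModuleHom f).lTensor U) fun g v => by
    induction v using TensorProduct.induction_on with
    | zero => simp
    | tmul x y => simp [ofModuleHom_rho]
    | add x y hx hy => rw [map_add, map_add, hx, hy, map_add, map_add]

theorem lTensorHom_id : lTensorHom τ (LinearMap.id : ρ.asModule →ₗ[MonoidAlgebra k G] ρ.asModule)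
    = LinearMap.id :=
  moduleHom_ext fun v => LinearMap.congr_fun (LinearMap.lTensor_id U V) v

theorem lTensorHom_comp {X : Type*} [AddCommGroup X] [Module k X] {χ : Representation k G X}
    (f : σ.asModule →ₗ[MonoidAlgebra k G] χ.asModule)
    (g : ρ.asModule →ₗ[MonoidAlgebra k G] σ.asModule) :
    lTensorHom τ (f ∘ₗ g) = lTensorHom τ f ∘ₗ lTensorHom τ g :=
  moduleHom_ext fun v => LinearMap.congr_fun
    (LinearMap.lTensor_comp U (ofModuleHom f) (ofModuleHom g)) v

theorem lTensorHom_add (f g : ρ.asModule →ₗ[MonoidAlgebra k G] σ.asModule) :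
    lTensorHom τ (f + g) = lTensorHom τ f + lTensorHom τ g :=
  moduleHom_ext fun v => LinearMap.congr_fun
    (LinearMap.lTensor_add U (ofModuleHom f) (ofModuleHom g)) v

theorem lTensorHom_zero :
    lTensorHom τ (0 : ρ.asModule →ₗ[MonoidAlgebra k G] σ.asModule) = 0 :=
  moduleHom_ext fun v => LinearMap.congr_fun (LinearMap.lTensor_zero U) v

end Representation

/-! ### Tensoring with the natural representation -/

namespace SL2Fp

open Representation

variable (p : ℕ) (k : Type*) [Field k] [CharP k p]

variable {p} in
/-- The image in `k` of an element of `SL₂(𝔽_p)`. -/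
noncomputable def toMat (g : Grp p) : Matrix (Fin 2) (Fin 2) k :=
  g.1.map (ZMod.castHom (dvd_refl p) k)

variable {p k}

theorem toMat_one : toMat k (1 : Grp p) = 1 := by
  rw [toMat, Matrix.SpecialLinearGroup.coe_one, Matrix.map_one _ (map_zero _) (map_one _)]

theorem toMat_mul (g h : Grp p) : toMat k (g * h) = toMat k g * toMat k h := by
  rw [toMat, Matrix.SpecialLinearGroup.coe_mul, Matrix.map_mul]; rfl

theorem toMat_det (g : Grp p) :
    toMat k g 0 0 * toMat k g 1 1 - toMat k g 0 1 * toMat k g 1 0 = 1 := by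
  have h := g.2
  rw [Matrix.det_fin_two] at h
  have h' := congrArg (ZMod.castHom (dvd_refl p) k) h
  rw [map_sub, map_mul, map_mul, map_one] at h'
  exact h'

theorem toMat_inv (g : Grp p) : toMat k g⁻¹ =
    !![toMat k g 1 1, -toMat k g 0 1; -toMat k g 1 0, toMat k g 0 0] := by
  rw [toMat, Matrix.SpecialLinearGroup.coe_inv, Matrix.adjugate_fin_two]
  ext i j
  fin_cases i <;> fin_cases j <;> simp [toMat]

variable {W : Type*} [AddCommGroup W] [Module k W]

/-- The tensor product of a representation with the natural two-dimensional representation. -/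
noncomputable def double (ρ : Representation k (Grp p) W) :
    Representation k (Grp p) (W × W) where
  toFun g := LinearMap.prod
    (toMat k g 0 0 • (ρ g ∘ₗ LinearMap.fst k W W) + toMat k g 0 1 • (ρ g ∘ₗ LinearMap.snd k W W))
    (toMat k g 1 0 • (ρ g ∘ₗ LinearMap.fst k W W) + toMat k g 1 1 • (ρ g ∘ₗ LinearMap.snd k W W))
  map_one' := by
    rw [toMat_one]
    refine LinearMap.ext fun v => ?_
    simp
  map_mul' g h := by
    refine LinearMap.ext fun v => Prod.ext ?_ ?_
    · change toMat k (g * h) 0 0 • ρ (g * h) v.1 + toMat k (g * h) 0 1 • ρ (g * h) v.2 =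
        toMat k g 0 0 • ρ g (toMat k h 0 0 • ρ h v.1 + toMat k h 0 1 • ρ h v.2) +
        toMat k g 0 1 • ρ g (toMat k h 1 0 • ρ h v.1 + toMat k h 1 1 • ρ h v.2)
      simp only [toMat_mul, Matrix.mul_apply, Fin.sum_univ_two, map_mul, Module.End.mul_apply,
        map_add, map_smul]
      module
    · change toMat k (g * h) 1 0 • ρ (g * h) v.1 + toMat k (g * h) 1 1 • ρ (g * h) v.2 =
        toMat k g 1 0 • ρ g (toMat k h 0 0 • ρ h v.1 + toMat k h 0 1 • ρ h v.2) +
        toMat k g 1 1 • ρ g (toMat k h 1 0 • ρ h v.1 + toMat k h 1 1 • ρ h v.2)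
      simp only [toMat_mul, Matrix.mul_apply, Fin.sum_univ_two, map_mul, Module.End.mul_apply,
        map_add, map_smul]
      module

theorem double_apply (ρ : Representation k (Grp p) W) (g : Grp p) (v : W × W) :
    double ρ g v = (toMat k g 0 0 • ρ g v.1 + toMat k g 0 1 • ρ g v.2,
      toMat k g 1 0 • ρ g v.1 + toMat k g 1 1 • ρ g v.2) := rfl

variable {U : Type*} [AddCommGroup U] [Module k U] {X : Type*} [AddCommGroup X] [Module k X]
  {ρ : Representation k (Grp p) W} {σ : Representation k (Grp p) U} {χ : Representation k (Grp p) X}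

/-- The functoriality of `double`. -/
noncomputable def doubleHom (f : ρ.asModule →ₗ[MonoidAlgebra k (Grp p)] σ.asModule) :
    (double ρ).asModule →ₗ[MonoidAlgebra k (Grp p)] (double σ).asModule :=
  toModuleHom ((ofModuleHom f).prodMap (ofModuleHom f)) fun g v => by
    simp [double_apply, ofModuleHom_rho]

theorem doubleHom_id : doubleHom (LinearMap.id : ρ.asModule →ₗ[MonoidAlgebra k (Grp p)] _) =
    LinearMap.id := rfl

theorem doubleHom_comp (f : σ.asModule →ₗ[MonoidAlgebra k (Grp p)] χ.asModule)
    (g : ρ.asModule →ₗ[MonoidAlgebra k (Grp p)] σ.asModule) :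
    doubleHom (f ∘ₗ g) = doubleHom f ∘ₗ doubleHom g := rfl

theorem doubleHom_zero :
    doubleHom (0 : ρ.asModule →ₗ[MonoidAlgebra k (Grp p)] σ.asModule) = 0 := rfl

/-- `doubleHom` as a homomorphism of additive groups. -/
noncomputable def doubleHomAdd : (ρ.asModule →ₗ[MonoidAlgebra k (Grp p)] σ.asModule) →+
    ((double ρ).asModule →ₗ[MonoidAlgebra k (Grp p)] (double σ).asModule) where
  toFun := doubleHom
  map_zero' := rfl
  map_add' _ _ := rfl

/-- Conjugating `id ⊗ φ` by `g` gives `id ⊗ g⁻¹ φ g`: the two actions on the natural factor cancel,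
which in coordinates is the adjugate formula together with determinant one. -/
theorem doubleHom_mem_traceHom [Fintype (Grp p)]
    {e : ρ.asModule →ₗ[MonoidAlgebra k (Grp p)] σ.asModule}
    (he : e ∈ traceHom k ρ.asModule σ.asModule) :
    doubleHom e ∈ traceHom k (double ρ).asModule (double σ).asModule := by
  rw [mem_traceHom_asModule_iff] at he ⊢
  obtain ⟨φ, hφ⟩ := he
  refine ⟨φ.prodMap φ, fun v => ?_⟩
  have h1 : ∀ g : Grp p, double σ g⁻¹ (φ.prodMap φ (double ρ g v)) =
      (σ g⁻¹ (φ (ρ g v.1)), σ g⁻¹ (φ (ρ g v.2))) := by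
    intro g
    have hdet := toMat_det (k := k) g
    simp only [double_apply, toMat_inv, LinearMap.prodMap_apply, map_add, map_smul, Matrix.of_apply,
      Matrix.cons_val', Matrix.cons_val_zero, Matrix.cons_val_one, Matrix.cons_val_fin_one]
    set x := σ g⁻¹ (φ (ρ g v.1))
    set y := σ g⁻¹ (φ (ρ g v.2))
    ext
    · dsimp only
      linear_combination (norm := module) hdet • x
    · dsimp only
      linear_combination (norm := module) hdet • y
  rw [Finset.sum_congr rfl fun g _ => h1 g]
  ext
  · rw [Prod.fst_sum]; exact hφ v.1
  · rw [Prod.snd_sum]; exact hφ v.2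

/-- Doubling is additive and preserves relative traces, so the projective complement of `ρ` adds
nothing and the summands can be doubled one at a time. -/
theorem _root_.HasSplitType.double [Fintype (Grp p)] {J : Type*} [Fintype J] [DecidableEq J]
    {E : J → Type*} [∀ j, AddCommGroup (E j)] [∀ j, Module k (E j)]
    {ψ : ∀ j, Representation k (Grp p) (E j)} {c : J → ℕ} {D : J → J → ℕ}
    (hD : ∀ j, HasSplitType k (Grp p) (fun j => (ψ j).asModule) (SL2Fp.double (ψ j)).asModule (D j))
    (h : HasSplitType k (Grp p) (fun j => (ψ j).asModule) ρ.asModule c) :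
    HasSplitType k (Grp p) (fun j => (ψ j).asModule) (SL2Fp.double ρ).asModule
      (∑ j, c j • D j) := by
  obtain ⟨T, _, _, j, ι, π, hid, hort, htr, hc⟩ := h
  have hglue := HasSplitType.glue (fun s => (SL2Fp.double (ψ (j s))).asModule)
    (fun s => doubleHom (ι s)) (fun s => doubleHom (π s))
    (fun s => by rw [← doubleHom_comp, hid, doubleHom_id])
    (fun s t hst => by rw [← doubleHom_comp, hort s t hst, doubleHom_zero])
    (by
      have := doubleHom_mem_traceHom htr
      have h2 := map_sub (doubleHomAdd (p := p) (ρ := ρ) (σ := ρ)) LinearMap.id (∑ s, ι s ∘ₗ π s)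
      rw [map_sum] at h2
      exact h2 ▸ this)
    (fun s => hD (j s))
  convert hglue using 1
  rw [← Finset.sum_fiberwise (s := Finset.univ) (g := j)]
  refine Finset.sum_congr rfl fun a _ => ?_
  rw [Finset.sum_congr rfl (g := fun _ => D a) (by simp +contextual), Finset.sum_const, hc,
    Nat.card_eq_fintype_card, Fintype.card_subtype]

variable (σ ρ) in
/-- `double` commutes with tensoring on the left. -/
noncomputable def tprodDouble :
    (σ.tprod (double ρ)).asModule ≃ₗ[MonoidAlgebra k (Grp p)] (double (σ.tprod ρ)).asModule :=
  LinearEquiv.ofBijective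
    (toModuleHom (TensorProduct.prodRight k k U W W).toLinearMap fun g v => by
      induction v using TensorProduct.induction_on with
      | zero => simp
      | tmul x y => simp [double_apply, TensorProduct.tmul_add, TensorProduct.tmul_smul]
      | add x y hx hy => rw [map_add, map_add, hx, hy, map_add, map_add])
    (TensorProduct.prodRight k k U W W).bijective

end SL2Fp

/-! ### Gradient, curl and the Clebsch–Gordan splitting -/

namespace SL2Fp

open Representation MvPolynomial

section Polynomials

variable {k : Type*} [Field k]

theorem subst_X_zero (m : Matrix (Fin 2) (Fin 2) k) :
    subst k m (X 0) = C (m 0 0) * X 0 + C (m 1 0) * X 1 := by simp [subst]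

theorem subst_X_one (m : Matrix (Fin 2) (Fin 2) k) :
    subst k m (X 1) = C (m 0 1) * X 0 + C (m 1 1) * X 1 := by simp [subst]

theorem subst_C (m : Matrix (Fin 2) (Fin 2) k) (c : k) : subst k m (C c) = C c := by
  simp [subst]

/-- Chain rule. It says that the gradient transforms as a pair in `double`. -/
theorem pderiv_subst (m : Matrix (Fin 2) (Fin 2) k) (i : Fin 2) (f : MvPolynomial (Fin 2) k) :
    pderiv i (subst k m f) =
      C (m i 0) * subst k m (pderiv 0 f) + C (m i 1) * subst k m (pderiv 1 f) := by
  induction f using MvPolynomial.induction_on with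
  | C a => simp
  | add f g hf hg => simp only [map_add, hf, hg]; ring
  | mul_X f j hf =>
    simp only [map_mul, pderiv_mul, hf, map_add]
    fin_cases i <;> fin_cases j <;> simp [subst_X_zero, subst_X_one, pderiv_X] <;> ring

theorem sum_X_mul_pderiv_fin_two {d : ℕ} {f : MvPolynomial (Fin 2) k} (hf : f.IsHomogeneous d) :
    X 0 * pderiv 0 f + X 1 * pderiv 1 f = C (d : k) * f := by
  have := hf.sum_X_mul_pderiv
  rw [Fin.sum_univ_two] at this
  rw [this, nsmul_eq_mul, map_natCast]

theorem pderiv_zero_one_comm (f : MvPolynomial (Fin 2) k) :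
    pderiv 0 (pderiv 1 f) = pderiv 1 (pderiv 0 f) := by
  ext m
  simp only [coeff_pderiv]
  simp [add_right_comm]
  ring

end Polynomials

variable (p : ℕ) (k : Type*) [Field k] [CharP k p]

/-- The representation of `SL₂(𝔽_p)` on the homogeneous polynomials of degree `d`. -/
noncomputable def H (d : ℕ) : Representation k (Grp p) (homogeneousSubmodule (Fin 2) k d) :=
  Subrepresentation.toRepresentation (ρ := polyRep p k)
    ⟨homogeneousSubmodule (Fin 2) k d, fun _ _ hf => subst_mem k _ _ hf⟩

variable {p k}

theorem coe_H_apply {d : ℕ} (g : Grp p) (f : homogeneousSubmodule (Fin 2) k d) :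
    (H p k d g f : MvPolynomial (Fin 2) k) = subst k (toMat k g) f := rfl

section LinearMaps

variable {k : Type*} [Field k] (d : ℕ)

/-- Multiplication by a variable. -/
noncomputable def mulVar (i : Fin 2) :
    homogeneousSubmodule (Fin 2) k d →ₗ[k] homogeneousSubmodule (Fin 2) k (d + 1) :=
  (LinearMap.mulRight k (X i : MvPolynomial (Fin 2) k)).restrict fun _ hf =>
    IsHomogeneous.mul hf (isHomogeneous_X k i)

/-- The partial derivative with respect to a variable. -/
noncomputable def diffVar (i : Fin 2) :
    homogeneousSubmodule (Fin 2) k (d + 1) →ₗ[k] homogeneousSubmodule (Fin 2) k d :=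
  (pderiv i).toLinearMap.restrict fun _ hf => IsHomogeneous.pderiv (i := i) hf

variable {d}

theorem coe_mulVar (i : Fin 2) (f : homogeneousSubmodule (Fin 2) k d) :
    (mulVar d i f : MvPolynomial (Fin 2) k) = f.1 * X i := rfl

theorem coe_diffVar (i : Fin 2) (f : homogeneousSubmodule (Fin 2) k (d + 1)) :
    (diffVar d i f : MvPolynomial (Fin 2) k) = pderiv i (f : MvPolynomial (Fin 2) k) := rfl

theorem mulVar_diffVar (f : homogeneousSubmodule (Fin 2) k (d + 1)) :
    mulVar d 0 (diffVar d 0 f) + mulVar d 1 (diffVar d 1 f) = ((d + 1 : ℕ) : k) • f := by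
  refine Subtype.ext ?_
  rw [Submodule.coe_add, Submodule.coe_smul, coe_mulVar, coe_mulVar, coe_diffVar, coe_diffVar,
    ← C_mul', ← sum_X_mul_pderiv_fin_two f.2]
  ring

theorem diffVar_comm (f : homogeneousSubmodule (Fin 2) k (d + 2)) :
    diffVar d 0 (diffVar (d + 1) 1 f) = diffVar d 1 (diffVar (d + 1) 0 f) :=
  Subtype.ext (pderiv_zero_one_comm f.1)

theorem mulVar_comm (f : homogeneousSubmodule (Fin 2) k d) :
    mulVar (d + 1) 0 (mulVar d 1 f) = mulVar (d + 1) 1 (mulVar d 0 f) := by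
  refine Subtype.ext ?_
  simp only [coe_mulVar]
  ring

theorem diffVar_mulVar_self (i : Fin 2) (f : homogeneousSubmodule (Fin 2) k (d + 1)) :
    diffVar (d + 1) i (mulVar (d + 1) i f) = f + mulVar d i (diffVar d i f) := by
  refine Subtype.ext ?_
  simp only [Submodule.coe_add, coe_diffVar, coe_mulVar, pderiv_mul, pderiv_X_self]
  ring

theorem diffVar_mulVar_of_ne {i j : Fin 2} (h : j ≠ i)
    (f : homogeneousSubmodule (Fin 2) k (d + 1)) :
    diffVar (d + 1) i (mulVar (d + 1) j f) = mulVar d j (diffVar d i f) := by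
  refine Subtype.ext ?_
  simp only [coe_diffVar, coe_mulVar, pderiv_mul, pderiv_X_of_ne h]
  ring

theorem exists_eq_C_of_degree_zero (f : homogeneousSubmodule (Fin 2) k 0) :
    ∃ c, (f : MvPolynomial (Fin 2) k) = C c := by
  obtain ⟨f, hf⟩ := f
  rw [homogeneousSubmodule_zero, Submodule.mem_one] at hf
  obtain ⟨c, hc⟩ := hf
  exact ⟨c, hc.symm⟩

theorem diffVar_mulVar_zero (i j : Fin 2) (f : homogeneousSubmodule (Fin 2) k 0) :
    diffVar 0 i (mulVar 0 j f) = if i = j then f else 0 := by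
  obtain ⟨c, hc⟩ := exists_eq_C_of_degree_zero f
  refine Subtype.ext ?_
  rw [coe_diffVar, coe_mulVar, hc, pderiv_C_mul]
  split_ifs with h
  · rw [h, pderiv_X_self, hc, mul_one]
  · rw [pderiv_X_of_ne (Ne.symm h), mul_zero]; rfl

end LinearMaps

section Equivariance

variable {d : ℕ} (g : Grp p)

theorem diffVar_H (i : Fin 2) (f : homogeneousSubmodule (Fin 2) k (d + 1)) :
    diffVar d i (H p k (d + 1) g f) =
      toMat k g i 0 • H p k d g (diffVar d 0 f) + toMat k g i 1 • H p k d g (diffVar d 1 f) := by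
  refine Subtype.ext ?_
  simp only [Submodule.coe_add, Submodule.coe_smul, coe_diffVar, coe_H_apply, pderiv_subst, C_mul']

theorem H_mulVar (i : Fin 2) (f : homogeneousSubmodule (Fin 2) k d) :
    H p k (d + 1) g (mulVar d i f) =
      toMat k g 0 i • mulVar d 0 (H p k d g f) + toMat k g 1 i • mulVar d 1 (H p k d g f) := by
  refine Subtype.ext ?_
  simp only [Submodule.coe_add, Submodule.coe_smul, coe_mulVar, coe_H_apply, map_mul, ← C_mul']
  fin_cases i
  · simp only [Fin.zero_eta, subst_X_zero]; ring
  · simp only [Fin.mk_one, subst_X_one]; ring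

end Equivariance

variable (p k)

/-- `f ↦ (∂f/∂X, ∂f/∂Y)` -/
noncomputable def gradHom (d : ℕ) :
    (H p k (d + 1)).asModule →ₗ[MonoidAlgebra k (Grp p)] (double (H p k d)).asModule :=
  toModuleHom ((diffVar d 0).prod (diffVar d 1)) fun g f =>
    Prod.ext (diffVar_H g 0 f) (diffVar_H g 1 f)

/-- `(f₀, f₁) ↦ X f₀ + Y f₁` -/
noncomputable def mulHom (d : ℕ) :
    (double (H p k d)).asModule →ₗ[MonoidAlgebra k (Grp p)] (H p k (d + 1)).asModule :=
  toModuleHom ((mulVar d 0).coprod (mulVar d 1)) fun g f => by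
    simp only [LinearMap.coprod_apply, double_apply, map_add, map_smul, H_mulVar]
    module

/-- `h ↦ (-Y h, X h)` -/
noncomputable def rotHom (d : ℕ) :
    (H p k d).asModule →ₗ[MonoidAlgebra k (Grp p)] (double (H p k (d + 1))).asModule :=
  toModuleHom ((-mulVar d 1).prod (mulVar d 0)) fun g f => by
    -- The pair `(-Y, X)` is an invariant vector because the determinant is one.
    have hdet := toMat_det (k := k) g
    simp only [LinearMap.prod_apply, Function.prod, double_apply, LinearMap.neg_apply, map_neg,
      H_mulVar]
    ext1
    · linear_combination (norm := module) hdet • mulVar d 1 (H p k d g f)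
    · linear_combination (norm := module) -hdet • mulVar d 0 (H p k d g f)

/-- `(f₀, f₁) ↦ ∂f₁/∂X - ∂f₀/∂Y` -/
noncomputable def curlHom (d : ℕ) :
    (double (H p k (d + 1))).asModule →ₗ[MonoidAlgebra k (Grp p)] (H p k d).asModule :=
  toModuleHom ((-diffVar d 1).coprod (diffVar d 0)) fun g f => by
    have hdet := toMat_det (k := k) g
    simp only [LinearMap.coprod_apply, double_apply, LinearMap.neg_apply, map_add, map_neg,
      map_smul, diffVar_H]
    linear_combination (norm := module)
      hdet • (H p k d g (diffVar d 0 f.2) - H p k d g (diffVar d 1 f.1))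

theorem mulHom_comp_gradHom (d : ℕ) :
    mulHom p k d ∘ₗ gradHom p k d = ((d + 1 : ℕ) : k) • LinearMap.id :=
  moduleHom_ext fun f => mulVar_diffVar f

/-- The product rule contributes `f` twice and Euler's identity contributes the degree `d + 1`.
Degree zero is separate because `diffVar` lands in a predecessor degree. -/
theorem curlHom_comp_rotHom_succ (d : ℕ) :
    curlHom p k (d + 1) ∘ₗ rotHom p k (d + 1) = ((d + 3 : ℕ) : k) • LinearMap.id :=
  moduleHom_ext fun f => by
    change -diffVar (d + 1) 1 (-mulVar (d + 1) 1 f) + diffVar (d + 1) 0 (mulVar (d + 1) 0 f) =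
      ((d + 3 : ℕ) : k) • f
    have := mulVar_diffVar f
    rw [map_neg, neg_neg, diffVar_mulVar_self, diffVar_mulVar_self]
    push_cast at this ⊢
    linear_combination (norm := module) this

theorem curlHom_comp_rotHom_zero :
    curlHom p k 0 ∘ₗ rotHom p k 0 = ((2 : ℕ) : k) • LinearMap.id :=
  moduleHom_ext fun f => by
    change -diffVar 0 1 (-mulVar 0 1 f) + diffVar 0 0 (mulVar 0 0 f) = ((2 : ℕ) : k) • f
    rw [map_neg, neg_neg, diffVar_mulVar_zero, diffVar_mulVar_zero, if_pos rfl, if_pos rfl,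
      Nat.cast_two, two_smul]

theorem curlHom_comp_rotHom (d : ℕ) :
    curlHom p k d ∘ₗ rotHom p k d = ((d + 2 : ℕ) : k) • LinearMap.id := by
  cases d with
  | zero => exact curlHom_comp_rotHom_zero p k
  | succ d => exact curlHom_comp_rotHom_succ p k d

theorem curlHom_comp_gradHom (d : ℕ) :
    curlHom p k d ∘ₗ gradHom p k (d + 1) = 0 :=
  moduleHom_ext fun f => by
    change -diffVar d 1 (diffVar (d + 1) 0 f) + diffVar d 0 (diffVar (d + 1) 1 f) = 0
    rw [diffVar_comm, neg_add_cancel]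

theorem mulHom_comp_rotHom (d : ℕ) :
    mulHom p k (d + 1) ∘ₗ rotHom p k d = 0 :=
  moduleHom_ext fun f => by
    change mulVar (d + 1) 0 (-mulVar d 1 f) + mulVar (d + 1) 1 (mulVar d 0 f) = 0
    rw [map_neg, mulVar_comm, neg_add_cancel]

/-- The mixed terms cancel, leaving `1` from the product rule and `d + 1` from Euler's identity. The
constant agrees with those of `mulHom ∘ gradHom` and `curlHom ∘ rotHom` in the same degrees, so
inverting `d + 2` alone normalises both projections. -/
theorem gradHom_mulHom_add_rotHom_curlHom (d : ℕ) :
    gradHom p k (d + 1) ∘ₗ mulHom p k (d + 1) + rotHom p k d ∘ₗ curlHom p k d =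
      ((d + 2 : ℕ) : k) • LinearMap.id := by
  refine moduleHom_ext fun f => Prod.ext ?_ ?_
  · change diffVar (d + 1) 0 (mulVar (d + 1) 0 f.1 + mulVar (d + 1) 1 f.2) +
      -mulVar d 1 (-diffVar d 1 f.1 + diffVar d 0 f.2) = ((d + 2 : ℕ) : k) • f.1
    have := mulVar_diffVar f.1
    rw [map_add, map_add, map_neg, diffVar_mulVar_self, diffVar_mulVar_of_ne (by decide)]
    push_cast at this ⊢
    linear_combination (norm := module) this
  · change diffVar (d + 1) 1 (mulVar (d + 1) 0 f.1 + mulVar (d + 1) 1 f.2) +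
      mulVar d 0 (-diffVar d 1 f.1 + diffVar d 0 f.2) = ((d + 2 : ℕ) : k) • f.2
    have := mulVar_diffVar f.2
    rw [map_add, map_add, map_neg, diffVar_mulVar_self, diffVar_mulVar_of_ne (by decide)]
    push_cast at this ⊢
    linear_combination (norm := module) this

theorem gradHom_comp_mulHom_zero : gradHom p k 0 ∘ₗ mulHom p k 0 = LinearMap.id := by
  refine moduleHom_ext fun f => Prod.ext ?_ ?_
  · change diffVar 0 0 (mulVar 0 0 f.1 + mulVar 0 1 f.2) = f.1
    rw [map_add, diffVar_mulVar_zero, diffVar_mulVar_zero]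
    simp
  · change diffVar 0 1 (mulVar 0 0 f.1 + mulVar 0 1 f.2) = f.2
    rw [map_add, diffVar_mulVar_zero, diffVar_mulVar_zero]
    simp

/-- The natural representation tensor the constants is the natural representation. -/
noncomputable def doubleZeroEquiv :
    (H p k 1).asModule ≃ₗ[MonoidAlgebra k (Grp p)] (double (H p k 0)).asModule :=
  LinearEquiv.ofLinearMap (gradHom p k 0) (mulHom p k 0) (gradHom_comp_mulHom_zero p k)
    (by rw [mulHom_comp_gradHom]; simp)

end SL2Fp

/-! ### Unipotent elements and Schur's lemma -/

/-- After applying a linear functional, this is a polynomial of degree less than `p` with `p`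
distinct roots. -/
theorem eq_zero_of_forall_sum_zmod_pow_smul_eq_zero {p : ℕ} [Fact p.Prime] (k : Type*) [Field k]
    [CharP k p] {E : Type*} [AddCommGroup E] [Module k E] {n : ℕ} (hn : n ≤ p) (c : ℕ → E)
    (h : ∀ t : ZMod p, ∑ s ∈ Finset.range n, (ZMod.castHom (dvd_refl p) k t) ^ s • c s = 0) :
    ∀ s < n, c s = 0 := by
  intro s hs
  rw [← Module.forall_dual_apply_eq_zero_iff k]
  intro l
  let q : Polynomial k := ∑ s ∈ Finset.range n, Polynomial.monomial s (l (c s))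
  have hq : q = 0 := by
    by_cases hn0 : n = 0
    · omega
    refine Polynomial.eq_zero_of_natDegree_lt_card_of_eval_eq_zero q
      (ZMod.castHom (dvd_refl p) k).injective (fun t => ?_) ?_
    · have := congrArg l (h t)
      rw [map_sum, map_zero] at this
      simp only [q, Polynomial.eval_finsetSum, Polynomial.eval_monomial]
      rw [← this]
      refine Finset.sum_congr rfl fun s _ => ?_
      rw [map_smul, smul_eq_mul, mul_comm]
    · rw [ZMod.card]
      refine lt_of_le_of_lt (Polynomial.natDegree_sum_le_of_forall_le (n := n - 1) _ _ ?_) (by omega)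
      intro i hi
      exact (Polynomial.natDegree_monomial_le _).trans (by have := Finset.mem_range.1 hi; omega)
  have := congrArg (fun f => Polynomial.coeff f s) hq
  simpa [q, Polynomial.finsetSum_coeff, Polynomial.coeff_monomial, hs] using this

namespace SL2Fp

open Representation MvPolynomial

section Monomials

/-- The exponent of `X ^ (d - s) * Y ^ s`. -/
noncomputable def expo (d s : ℕ) : Fin 2 →₀ ℕ := Finsupp.single 0 (d - s) + Finsupp.single 1 s

theorem expo_one (d s : ℕ) : expo d s 1 = s := by simp [expo]

theorem expo_zero (d s : ℕ) : expo d s 0 = d - s := by simp [expo]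

theorem degree_expo {d s : ℕ} (hs : s ≤ d) : (expo d s).degree = d := by
  rw [Finsupp.degree_eq_sum, Fin.sum_univ_two, expo_one, expo_zero]
  omega

theorem expo_eq {d : ℕ} {m : Fin 2 →₀ ℕ} (hm : m.degree = d) : expo d (m 1) = m := by
  rw [Finsupp.degree_eq_sum, Fin.sum_univ_two] at hm
  ext i
  fin_cases i
  · simp only [Fin.zero_eta, expo_zero]; omega
  · simp only [Fin.mk_one, expo_one]

variable (k : Type*) [Field k] (d : ℕ)

/-- The monomial `X ^ (d - s) * Y ^ s`, or zero when `d < s`. -/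
noncomputable def monom (s : ℕ) : homogeneousSubmodule (Fin 2) k d :=
  ⟨if s ≤ d then monomial (expo d s) 1 else 0, by
    split_ifs with h
    · exact isHomogeneous_monomial _ (degree_expo h)
    · exact zero_mem _⟩

variable {k d}

theorem coe_monom_eq_monomial {s : ℕ} (hs : s ≤ d) :
    (monom k d s : MvPolynomial (Fin 2) k) = monomial (expo d s) 1 := if_pos hs

theorem coe_monom {s : ℕ} (hs : s ≤ d) :
    (monom k d s : MvPolynomial (Fin 2) k) = X 0 ^ (d - s) * X 1 ^ s := by
  rw [coe_monom_eq_monomial hs, expo, X_pow_eq_monomial, X_pow_eq_monomial, monomial_mul, one_mul]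

theorem coeff_monom {s t : ℕ} (ht : t ≤ d) :
    coeff (expo d s) (monom k d t : MvPolynomial (Fin 2) k) = if t = s then 1 else 0 := by
  rw [coe_monom_eq_monomial ht, coeff_monomial]
  refine if_congr ⟨fun h => ?_, fun h => by rw [h]⟩ rfl rfl
  rw [← expo_one d t, h, expo_one]

theorem eq_sum_monom (f : homogeneousSubmodule (Fin 2) k d) :
    f = ∑ s ∈ Finset.range (d + 1), coeff (expo d s) f.1 • monom k d s := by
  refine Subtype.ext (MvPolynomial.ext _ _ fun m => ?_)
  rw [Submodule.coe_sum, coeff_sum]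
  simp only [Submodule.coe_smul, coeff_smul, smul_eq_mul]
  by_cases hm : m.degree = d
  · have hm1 : m 1 ≤ d := by
      rw [Finsupp.degree_eq_sum, Fin.sum_univ_two] at hm
      omega
    rw [← expo_eq hm, Finset.sum_eq_single (m 1)]
    · rw [coeff_monom hm1, if_pos rfl, mul_one]
    · intro s hs hne
      rw [coeff_monom (by have := Finset.mem_range.1 hs; omega), if_neg hne, mul_zero]
    · intro h
      exact (h (Finset.mem_range.2 (by omega))).elim
  · rw [IsHomogeneous.coeff_eq_zero f.2 hm, Finset.sum_eq_zero]
    intro s _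
    rw [IsHomogeneous.coeff_eq_zero (monom k d s).2 hm, mul_zero]

theorem linearMap_ext_monom {E : Type*} [AddCommGroup E] [Module k E]
    {f g : homogeneousSubmodule (Fin 2) k d →ₗ[k] E} (h : ∀ s ≤ d, f (monom k d s) = g (monom k d s)) :
    f = g := by
  refine LinearMap.ext fun v => ?_
  rw [eq_sum_monom v, map_sum, map_sum]
  refine Finset.sum_congr rfl fun s hs => ?_
  rw [map_smul, map_smul, h s (by have := Finset.mem_range.1 hs; omega)]

theorem monom_ne_zero {s : ℕ} (hs : s ≤ d) : (monom k d s : homogeneousSubmodule (Fin 2) k d) ≠ 0 := by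
  intro h
  have := coeff_monom (k := k) (s := s) hs
  rw [h] at this
  simp at this

variable (k d)

/-- The coordinates of a homogeneous polynomial in two variables. -/
noncomputable def coordEquiv : homogeneousSubmodule (Fin 2) k d ≃ₗ[k] (Fin (d + 1) → k) :=
  LinearEquiv.ofLinearMap
    (LinearMap.pi fun s => (lcoeff k (expo d s)) ∘ₗ Submodule.subtype _)
    (∑ s : Fin (d + 1), (LinearMap.toSpanSingleton k _ (monom k d s)) ∘ₗ LinearMap.proj (φ := fun _ : Fin (d + 1) => k) s)
    (by
      refine LinearMap.ext fun c => funext fun s => ?_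
      simp only [LinearMap.comp_apply, LinearMap.sum_apply, LinearMap.pi_apply,
        LinearMap.proj_apply, LinearMap.toSpanSingleton_apply, Submodule.subtype_apply,
        map_sum, LinearMap.id_apply, map_smul, lcoeff_apply]
      rw [Finset.sum_eq_single s]
      · rw [coeff_monom (by omega), if_pos rfl, smul_eq_mul, mul_one]
      · intro t _ hne
        rw [coeff_monom (by omega), if_neg (fun h => hne (Fin.ext h)), smul_zero]
      · simp)
    (by
      refine LinearMap.ext fun f => ?_
      simp only [LinearMap.comp_apply, LinearMap.sum_apply, LinearMap.pi_apply,
        LinearMap.proj_apply, LinearMap.toSpanSingleton_apply, Submodule.subtype_apply,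
        LinearMap.id_apply, lcoeff_apply]
      rw [Fin.sum_univ_eq_sum_range (fun s => coeff (expo d s) f.1 • monom k d s)]
      exact (eq_sum_monom f).symm)

instance finiteDimensional_homogeneousSubmodule :
    FiniteDimensional k (homogeneousSubmodule (Fin 2) k d) :=
  LinearEquiv.finiteDimensional (coordEquiv k d).symm

theorem finrank_homogeneousSubmodule :
    Module.finrank k (homogeneousSubmodule (Fin 2) k d) = d + 1 := by
  rw [(coordEquiv k d).finrank_eq, Module.finrank_fin_fun]

end Monomials

section Elements

variable {p : ℕ}

/-- The lower unitriangular matrices. -/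
def lower (t : ZMod p) : Grp p := ⟨!![1, 0; t, 1], by simp [Matrix.det_fin_two]⟩

/-- The upper unitriangular matrices. -/
def upper (t : ZMod p) : Grp p := ⟨!![1, t; 0, 1], by simp [Matrix.det_fin_two]⟩

variable (p) in
/-- The Weyl element. -/
def weyl : Grp p := ⟨!![0, -1; 1, 0], by simp [Matrix.det_fin_two]⟩

theorem upper_mul (s t : ZMod p) : upper s * upper t = upper (s + t) := by
  refine Subtype.ext ?_
  rw [Matrix.SpecialLinearGroup.coe_mul]
  simp [upper, add_comm]

theorem upper_zero : upper (0 : ZMod p) = 1 := by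
  refine Subtype.ext ?_
  rw [Matrix.SpecialLinearGroup.coe_one]
  simp [upper, Matrix.one_fin_two]

theorem upper_one_pow (n : ℕ) : upper (1 : ZMod p) ^ n = upper (n : ZMod p) := by
  induction n with
  | zero => simp [upper_zero]
  | succ n ih => rw [pow_succ, ih, upper_mul, Nat.cast_succ]

/-- The element `upper 1` has order `p`. -/
theorem card_grp_eq_zero [Fact p.Prime] [Fintype (Grp p)] (k : Type*) [Field k] [CharP k p] :
    (Fintype.card (Grp p) : k) = 0 := by
  rw [CharP.cast_eq_zero_iff k p]
  have h : orderOf (upper (1 : ZMod p)) = p := by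
    refine orderOf_eq_prime (by rw [upper_one_pow, CharP.cast_eq_zero, upper_zero]) fun h => ?_
    have := congrArg (fun g : Grp p => g.1 0 1) h
    simp [upper] at this
  exact h.symm.dvd.trans (orderOf_dvd_card (x := upper (1 : ZMod p)))

variable {k : Type*} [Field k] [CharP k p]

theorem aeval_subst (m : Matrix (Fin 2) (Fin 2) k) (x y : k) (f : MvPolynomial (Fin 2) k) :
    aeval ![x, y] (subst k m f) =
      aeval ![m 0 0 * x + m 1 0 * y, m 0 1 * x + m 1 1 * y] f := by
  rw [subst, ← AlgHom.comp_apply, comp_aeval]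
  congr 2
  ext i
  fin_cases i <;> simp

theorem subst_lower_monom_zero (d : ℕ) (t : ZMod p) :
    H p k d (lower t) (monom k d 0) = ∑ s ∈ Finset.range (d + 1),
      (ZMod.castHom (dvd_refl p) k t) ^ s • (d.choose s : k) • monom k d s := by
  refine Subtype.ext ?_
  rw [coe_H_apply, coe_monom (Nat.zero_le d), Submodule.coe_sum, map_mul, map_pow, map_pow,
    subst_X_zero]
  have h1 : toMat k (lower t) 0 0 = 1 := by simp [toMat, lower]
  have h2 : toMat k (lower t) 1 0 = ZMod.castHom (dvd_refl p) k t := by simp [toMat, lower]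
  rw [h1, h2, map_one, one_mul, pow_zero, mul_one, Nat.sub_zero, add_comm, add_pow]
  refine Finset.sum_congr rfl fun s hs => ?_
  rw [Submodule.coe_smul, Submodule.coe_smul, coe_monom (by have := Finset.mem_range.1 hs; omega),
    ← C_mul', ← C_mul', mul_pow, ← map_pow, map_natCast]
  ring

theorem weyl_monom_zero (d : ℕ) : H p k d (weyl p) (monom k d 0) = monom k d d := by
  refine Subtype.ext ?_
  rw [coe_H_apply, coe_monom (Nat.zero_le d), coe_monom le_rfl, map_mul, map_pow, map_pow,
    subst_X_zero]
  have h1 : toMat k (weyl p) 0 0 = 0 := by simp [toMat, weyl]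
  have h2 : toMat k (weyl p) 1 0 = 1 := by simp [toMat, weyl]
  rw [h1, h2]
  simp

theorem upper_monom_zero (d : ℕ) (t : ZMod p) :
    H p k d (upper t) (monom k d 0) = monom k d 0 := by
  refine Subtype.ext ?_
  rw [coe_H_apply, coe_monom (Nat.zero_le d), map_mul, map_pow, map_pow, subst_X_zero]
  have h1 : toMat k (upper t) 0 0 = 1 := by simp [toMat, upper]
  have h2 : toMat k (upper t) 1 0 = 0 := by simp [toMat, upper]
  rw [h1, h2]
  simp

/-- Evaluating the invariance under `upper t` at `(1, 0)` gives `f(1, t) = f(1, 0)` on all of `𝔽_p`.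
As `f(1, t)` has degree less than `p` in `t`, it is constant. -/
theorem eq_smul_monom_zero_of_upper_invariant [Fact p.Prime] {d : ℕ} (hd : d < p)
    (f : homogeneousSubmodule (Fin 2) k d) (hf : ∀ t : ZMod p, H p k d (upper t) f = f) :
    f = coeff (expo d 0) f.1 • monom k d 0 := by
  have hev : ∀ x : k, aeval ![1, x] f.1 =
      ∑ s ∈ Finset.range (d + 1), x ^ s • coeff (expo d s) f.1 := by
    intro x
    conv_lhs => rw [eq_sum_monom f]
    rw [Submodule.coe_sum, map_sum]
    refine Finset.sum_congr rfl fun s hs => ?_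
    rw [Submodule.coe_smul, map_smul, coe_monom (by have := Finset.mem_range.1 hs; omega)]
    simp [mul_comm]
  have h0 : ∀ t : ZMod p, aeval ![1, ZMod.castHom (dvd_refl p) k t] f.1 =
      aeval ![(1 : k), 0] f.1 := by
    intro t
    conv_rhs => rw [← hf t, coe_H_apply, aeval_subst]
    simp [toMat, upper]
  have hz : ∀ s < d + 1, (if s = 0 then 0 else coeff (expo d s) f.1 : k) = 0 := by
    refine eq_zero_of_forall_sum_zmod_pow_smul_eq_zero (p := p) k (by omega)
      (fun s => if s = 0 then 0 else coeff (expo d s) f.1) fun t => ?_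
    have h1 := h0 t
    rw [hev, hev, Finset.sum_range_succ', Finset.sum_range_succ'] at h1
    rw [Finset.sum_range_succ']
    simpa using h1
  conv_lhs => rw [eq_sum_monom f]
  rw [Finset.sum_eq_single 0]
  · intro s hs hs0
    have := hz s (Finset.mem_range.1 hs)
    rw [if_neg hs0] at this
    rw [this, zero_smul]
  · simp

end Elements

section Schur

variable {p : ℕ} [Fact p.Prime] {k : Type*} [Field k] [CharP k p]

/-- `X ^ d` is fixed by the upper unipotents, so its image is `c X ^ e`. Applying `lower t` turns
these powers into `(X + tY) ^ d` and `c (X + tY) ^ e`, and coefficients of `t ^ s` may be compared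
below `p`. -/
theorem exists_moduleHom_monom {d e : ℕ} (hd : d < p) (he : e < p)
    (T : (H p k d).asModule →ₗ[MonoidAlgebra k (Grp p)] (H p k e).asModule) :
    ∃ c : k, ofModuleHom T (monom k d 0) = c • monom k e 0 ∧
      ∀ s < p, (d.choose s : k) • ofModuleHom T (monom k d s) = (c * e.choose s) • monom k e s := by
  obtain ⟨c, hc⟩ : ∃ c : k, ofModuleHom T (monom k d 0) = c • monom k e 0 :=
    ⟨_, eq_smul_monom_zero_of_upper_invariant he _ fun t => by
      rw [← ofModuleHom_rho, upper_monom_zero]⟩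
  refine ⟨c, hc, fun s hs => ?_⟩
  -- Binomials vanish beyond `d`, so both expansions can be padded to the common length `p`.
  have hext : ∀ (i d : ℕ) (_ : d < p) (F : ℕ → homogeneousSubmodule (Fin 2) k i) (x : k),
      ∑ s ∈ Finset.range (d + 1), x ^ s • (d.choose s : k) • F s =
      ∑ s ∈ Finset.range p, x ^ s • (d.choose s : k) • F s := by
    intro i d hd F x
    refine Finset.sum_subset (Finset.range_subset_range.2 hd) fun s _ hs => ?_
    rw [Nat.choose_eq_zero_of_lt (by rw [Finset.mem_range] at hs; omega), Nat.cast_zero, zero_smul,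
      smul_zero]
  rw [← sub_eq_zero]
  refine eq_zero_of_forall_sum_zmod_pow_smul_eq_zero (p := p) k le_rfl (fun s =>
    (d.choose s : k) • ofModuleHom T (monom k d s) - (c * e.choose s) • monom k e s) (fun t => ?_) s hs
  have h1 := ofModuleHom_rho T (lower t) (monom k d 0)
  rw [hc, map_smul, subst_lower_monom_zero, subst_lower_monom_zero, hext d d hd, hext e e he, map_sum,
    Finset.smul_sum, ← sub_eq_zero, ← Finset.sum_sub_distrib] at h1
  rw [← h1]
  refine Finset.sum_congr rfl fun s _ => ?_
  rw [map_smul, map_smul, smul_sub, smul_comm c, mul_smul]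

theorem choose_cast_ne_zero {d s : ℕ} (hd : d < p) (hs : s ≤ d) : (d.choose s : k) ≠ 0 := by
  rw [Ne, CharP.cast_eq_zero_iff k p]
  intro h
  have h2 : p ∣ d.factorial := by
    rw [← Nat.choose_mul_factorial_mul_factorial hs, mul_assoc]
    exact h.mul_right _
  exact absurd ((Nat.Prime.dvd_factorial Fact.out).1 h2) (by omega)

theorem H_end_eq_smul {d : ℕ} (hd : d < p)
    (T : (H p k d).asModule →ₗ[MonoidAlgebra k (Grp p)] (H p k d).asModule) :
    ∃ c : k, T = c • LinearMap.id := by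
  obtain ⟨c, -, hc⟩ := exists_moduleHom_monom hd hd T
  refine ⟨c, moduleHom_ext fun v => ?_⟩
  have : ofModuleHom T = c • LinearMap.id := by
    refine linearMap_ext_monom fun s hs => ?_
    have h := hc s (by omega)
    rw [mul_comm, mul_smul] at h
    exact smul_right_injective _ (choose_cast_ne_zero hd hs) h
  rw [this]
  rfl

theorem H_hom_eq_zero {d e : ℕ} (hd : d < p) (he : e < p) (hde : d ≠ e)
    (T : (H p k d).asModule →ₗ[MonoidAlgebra k (Grp p)] (H p k e).asModule) : T = 0 := by
  obtain ⟨c, hc0, hc⟩ := exists_moduleHom_monom hd he T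
  have hc' : c = 0 := by
    -- If `d < e`, the coefficient `s = e` reads `0 = c Y ^ e`. If `d > e`, the coefficient `s = d`
    -- says that `Y ^ d` maps to zero, but the Weyl element carries `X ^ d ↦ c X ^ e` to `Y ^ d ↦ c
    -- Y ^ e`.
    rcases lt_or_gt_of_ne hde with h | h
    · have h1 := hc e he
      rw [Nat.choose_eq_zero_of_lt h, Nat.choose_self, Nat.cast_zero, zero_smul, Nat.cast_one,
        mul_one] at h1
      exact (smul_eq_zero.1 h1.symm).resolve_right (monom_ne_zero le_rfl)
    · have h1 := hc d hd
      rw [Nat.choose_eq_zero_of_lt h, Nat.choose_self, Nat.cast_zero, mul_zero, zero_smul,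
        Nat.cast_one, one_smul, ← weyl_monom_zero (p := p), ofModuleHom_rho, hc0, map_smul,
        weyl_monom_zero] at h1
      exact (smul_eq_zero.1 h1).resolve_right (monom_ne_zero le_rfl)
  refine moduleHom_ext fun v => ?_
  have : ofModuleHom T = 0 := by
    refine linearMap_ext_monom fun s hs => ?_
    have h := hc s (by omega)
    rw [hc', zero_mul, zero_smul] at h
    exact (smul_eq_zero.1 h).resolve_left (choose_cast_ne_zero hd hs)
  rw [this]
  rfl

variable (p k) in
theorem isSplitFamily_H [Fintype (Grp p)] :
    IsSplitFamily k (Grp p) (fun d : Fin (p - 1) => (H p k d).asModule) where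
  card_eq_zero := card_grp_eq_zero k
  finite d := finiteDimensional_homogeneousSubmodule k d
  finrank_ne_zero d := by
    have h : Module.finrank k (H p k d).asModule = d + 1 := finrank_homogeneousSubmodule k d
    rw [h, Ne, CharP.cast_eq_zero_iff k p]
    exact fun h => absurd (Nat.le_of_dvd (by omega) h) (by omega)
  end_eq_smul d T := H_end_eq_smul (by omega) T
  hom_eq_zero d e hde T := H_hom_eq_zero (by omega) (by omega) (fun h => hde (Fin.ext h)) T

end Schur

end SL2Fp

/-! ### Projectivity of the Steinberg module -/

namespace SL2Fp

open Representation MvPolynomial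

section PowerSums

variable {p : ℕ} [Fact p.Prime] {k : Type*} [Field k] [CharP k p]

/-- By Pascal's rule and `p ∣ p.choose (m + 1)`, neighbouring values are opposite. -/
theorem choose_pred_cast {m : ℕ} (hm : m < p) : (((p - 1).choose m : ℕ) : k) = (-1) ^ m := by
  induction m with
  | zero => simp
  | succ m ih =>
    have h1 : p.choose (m + 1) = (p - 1).choose m + (p - 1).choose (m + 1) := by
      rw [← Nat.choose_succ_succ, Nat.succ_eq_add_one, Nat.sub_add_cancel (by omega)]
    have h2 : ((p.choose (m + 1) : ℕ) : k) = 0 := by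
      rw [CharP.cast_eq_zero_iff k p]
      exact Nat.Prime.dvd_choose_self Fact.out (by omega) hm
    rw [h1, Nat.cast_add, ih (by omega)] at h2
    rw [pow_succ]
    linear_combination h2

theorem sum_zmod_pow_of_lt {i : ℕ} (hi : i < p - 1) :
    ∑ t : ZMod p, (ZMod.castHom (dvd_refl p) k t) ^ i = 0 := by
  have h := FiniteField.sum_pow_lt_card_sub_one (ZMod p) i (by rwa [ZMod.card])
  have h2 := congrArg (ZMod.castHom (dvd_refl p) k) h
  rw [map_sum, map_zero] at h2
  rw [← h2]
  exact Finset.sum_congr rfl fun t _ => (map_pow _ _ _).symm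

theorem sum_zmod_pow_pred :
    ∑ t : ZMod p, (ZMod.castHom (dvd_refl p) k t) ^ (p - 1) = -1 := by
  have hp : 1 < p := Nat.Prime.one_lt Fact.out
  have h1 : ∀ t : ZMod p, (ZMod.castHom (dvd_refl p) k t) ^ (p - 1) = if t = 0 then 0 else 1 := by
    intro t
    split_ifs with h
    · rw [h, map_zero, zero_pow (by omega)]
    · rw [← map_pow, ZMod.pow_card_sub_one_eq_one h, map_one]
  rw [Finset.sum_congr rfl fun t _ => h1 t, Finset.sum_ite, Finset.sum_const_zero, zero_add,
    Finset.sum_const, nsmul_one, Finset.filter_not, Finset.card_sdiff_of_subset (by simp)]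
  simp [Finset.filter_eq', ZMod.card, Nat.cast_sub hp.le]

/-- Only the top power of `t` has a nonzero sum over `𝔽_p`, and that sum is `-1`. -/
theorem sum_add_smul_pow_pred {A : Type*} [CommRing A] [Algebra k A] (a b : A) :
    ∑ t : ZMod p, (a + ZMod.castHom (dvd_refl p) k t • b) ^ (p - 1) = -b ^ (p - 1) := by
  have h1 : ∀ t : ZMod p, (a + ZMod.castHom (dvd_refl p) k t • b) ^ (p - 1) =
      ∑ m ∈ Finset.range (p - 1 + 1), (ZMod.castHom (dvd_refl p) k t) ^ m •
        (b ^ m * a ^ (p - 1 - m) * ((p - 1).choose m : A)) := by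
    intro t
    rw [add_comm, add_pow]
    refine Finset.sum_congr rfl fun m _ => ?_
    rw [smul_pow, smul_mul_assoc, smul_mul_assoc]
  rw [Finset.sum_congr rfl fun t _ => h1 t, Finset.sum_comm]
  simp only [← Finset.sum_smul]
  rw [Finset.sum_range_succ, Finset.sum_eq_zero fun m hm => by
    rw [sum_zmod_pow_of_lt (Finset.mem_range.1 hm), zero_smul], sum_zmod_pow_pred]
  simp

end PowerSums

section LinForm

variable {p : ℕ} (k : Type*) [Field k] [CharP k p]

/-- The linear form `a Y - b X`. -/
noncomputable def linForm (a b : ZMod p) : MvPolynomial (Fin 2) k :=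
  C (ZMod.castHom (dvd_refl p) k a) * X 1 - C (ZMod.castHom (dvd_refl p) k b) * X 0

variable {k}

theorem linForm_pow (c d : ZMod p) (n : ℕ) :
    linForm k c d ^ n = ∑ m ∈ Finset.range (n + 1),
      ((ZMod.castHom (dvd_refl p) k c) ^ (n - m) * (ZMod.castHom (dvd_refl p) k d) ^ m) •
        (((-1) ^ m * (n.choose m : k)) • (X 0 ^ m * X 1 ^ (n - m) : MvPolynomial (Fin 2) k)) := by
  rw [linForm, sub_eq_neg_add, add_pow]
  refine Finset.sum_congr rfl fun m _ => ?_
  simp only [← C_mul', map_mul, map_pow, map_neg, map_one, map_natCast]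
  rw [mul_pow, neg_pow, mul_pow]
  ring

end LinForm

section Steinberg

variable {p : ℕ} [Fact p.Prime] {k : Type*} [Field k] [CharP k p]

theorem eq_upper_mul_of_row_eq {g h : Grp p} (h0 : g.1 1 0 = h.1 1 0) (h1 : g.1 1 1 = h.1 1 1) :
    g = upper (g.1 0 1 * h.1 0 0 - g.1 0 0 * h.1 0 1) * h := by
  have hg := g.2
  have hh := h.2
  rw [Matrix.det_fin_two] at hg hh
  refine Subtype.ext ?_
  rw [Matrix.SpecialLinearGroup.coe_mul]
  ext i j
  fin_cases i <;> fin_cases j <;> simp [upper, Matrix.mul_apply, Fin.sum_univ_two, h0, h1]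
  · rw [h0, h1] at hg
    linear_combination h.1 0 0 * hg - g.1 0 0 * hh
  · rw [h0, h1] at hg
    linear_combination h.1 0 1 * hg - g.1 0 1 * hh

/-- Matrices with bottom row `(c, d) ≠ 0` form a coset `{upper t * h}`, along which the linear form
of the top row moves by `t` times that of the bottom row. For `(c, d) = 0` the fibre is empty and
the right side is zero. -/
theorem sum_fiber_linForm_pow [DecidableEq (Grp p)] (c d : ZMod p) :
    ∑ g : Grp p with (g.1 1 0, g.1 1 1) = (c, d), linForm k (g.1 0 0) (g.1 0 1) ^ (p - 1) =
      -linForm k c d ^ (p - 1) := by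
  have hp : 1 < p := Nat.Prime.one_lt Fact.out
  by_cases hcd : c = 0 ∧ d = 0
  · obtain ⟨rfl, rfl⟩ := hcd
    rw [Finset.sum_eq_zero]
    · simp [linForm, zero_pow (show p - 1 ≠ 0 by omega)]
    · intro g hg
      rw [Finset.mem_filter, Prod.mk.injEq] at hg
      have := g.2
      rw [Matrix.det_fin_two, hg.2.1, hg.2.2] at this
      simp at this
  · have hcop : IsCoprime c d := by
      by_cases hc : c = 0
      · exact (IsCoprime.symm ⟨d⁻¹, 0, by rw [inv_mul_cancel₀ (fun hd => hcd ⟨hc, hd⟩)]; simp⟩)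
      · exact ⟨c⁻¹, 0, by rw [inv_mul_cancel₀ hc]; simp⟩
    obtain ⟨h, hc, hd⟩ := hcop.exists_SL2_row 1
    change h.1 1 0 = c at hc
    change h.1 1 1 = d at hd
    rw [← sum_add_smul_pow_pred (p := p) (k := k) (linForm k (h.1 0 0) (h.1 0 1))]
    symm
    refine Finset.sum_bij (fun t _ => upper t * h) (fun t _ => ?_) (fun s _ t _ hst => ?_)
      (fun g hg => ?_) (fun t _ => ?_)
    · simp only [Finset.mem_filter, Finset.mem_univ, true_and, Matrix.SpecialLinearGroup.coe_mul]
      simp [upper, Matrix.mul_apply, Fin.sum_univ_two, hc, hd]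
    · have := congrArg (fun g : Grp p => g.1 0 1) (mul_right_cancel hst)
      simpa [upper] using this
    · rw [Finset.mem_filter, Prod.mk.injEq, ← hc, ← hd] at hg
      exact ⟨_, Finset.mem_univ _, (eq_upper_mul_of_row_eq hg.2.1 hg.2.2).symm⟩
    · congr 1
      rw [Matrix.SpecialLinearGroup.coe_mul]
      simp only [linForm, upper, Matrix.mul_apply, Fin.sum_univ_two, Matrix.of_apply,
        Matrix.cons_val', Matrix.cons_val_zero, Matrix.cons_val_one, Matrix.cons_val_fin_one,
        hc, hd, one_mul, map_add, map_mul, ← C_mul']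
      ring

/-- After expansion the exponents of `c` and `d` add up to `2(p - 1)`. Unless both equal `p - 1`,
one is smaller and its power sum vanishes; the surviving term has coefficient `(-1)(-1) = 1`. -/
theorem sum_smul_linForm_pow {s : ℕ} (hs : s ≤ p - 1) :
    ∑ c : ZMod p, ∑ d : ZMod p, ((ZMod.castHom (dvd_refl p) k c) ^ (p - 1 - s) *
      (ZMod.castHom (dvd_refl p) k d) ^ s) • linForm k c d ^ (p - 1) =
      X 0 ^ (p - 1 - s) * X 1 ^ s := by
  have hp : 1 < p := Nat.Prime.one_lt Fact.out
  set ι := ZMod.castHom (dvd_refl p) k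
  have h1 : ∀ c d : ZMod p, (ι c ^ (p - 1 - s) * ι d ^ s) • linForm k c d ^ (p - 1) =
      ∑ m ∈ Finset.range (p - 1 + 1), (ι c ^ (p - 1 - s + (p - 1 - m)) * ι d ^ (s + m)) •
        (X 0 ^ m * X 1 ^ (p - 1 - m) : MvPolynomial (Fin 2) k) := by
    intro c d
    rw [linForm_pow, Finset.smul_sum]
    refine Finset.sum_congr rfl fun m hm => ?_
    rw [choose_pred_cast (by have := Finset.mem_range.1 hm; omega), ← mul_pow]
    simp only [mul_neg, mul_one, neg_neg, one_pow, one_smul, smul_smul, pow_add]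
    congr 1
    ring
  simp only [h1]
  rw [Finset.sum_congr rfl fun c _ => Finset.sum_comm, Finset.sum_comm]
  simp only [← Finset.sum_smul, ← Finset.mul_sum]
  simp only [← Finset.sum_mul]
  rw [Finset.sum_eq_single (p - 1 - s)]
  · rw [show p - 1 - s + (p - 1 - (p - 1 - s)) = p - 1 by omega,
      show s + (p - 1 - s) = p - 1 by omega, show p - 1 - (p - 1 - s) = s by omega,
      sum_zmod_pow_pred]
    simp
  · intro m hm hne
    have hm := Finset.mem_range.1 hm
    rcases lt_or_gt_of_ne hne with h | h
    · rw [sum_zmod_pow_of_lt (show s + m < p - 1 by omega), mul_zero, zero_smul]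
    · rw [sum_zmod_pow_of_lt (show p - 1 - s + (p - 1 - m) < p - 1 by omega), zero_mul, zero_smul]
  · intro h
    exact (h (Finset.mem_range.2 (by omega))).elim

theorem sum_aeval_smul_linForm_pow (f : homogeneousSubmodule (Fin 2) k (p - 1)) :
    ∑ x : ZMod p × ZMod p, aeval ![ZMod.castHom (dvd_refl p) k x.1, ZMod.castHom (dvd_refl p) k x.2]
      f.1 • linForm k x.1 x.2 ^ (p - 1) = f.1 := by
  let L : homogeneousSubmodule (Fin 2) k (p - 1) →ₗ[k] MvPolynomial (Fin 2) k :=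
    ∑ x : ZMod p × ZMod p, (LinearMap.toSpanSingleton k _ (linForm k x.1 x.2 ^ (p - 1))) ∘ₗ
      (aeval ![ZMod.castHom (dvd_refl p) k x.1, ZMod.castHom (dvd_refl p) k x.2]).toLinearMap ∘ₗ
        Submodule.subtype _
  have hL : L = Submodule.subtype _ := by
    refine linearMap_ext_monom fun s hs => ?_
    rw [Submodule.subtype_apply, coe_monom hs, ← sum_smul_linForm_pow hs, ← Fintype.sum_prod_type']
    simp only [L, LinearMap.sum_apply, LinearMap.comp_apply, Submodule.subtype_apply,
      LinearMap.toSpanSingleton_apply, AlgHom.toLinearMap_apply, coe_monom hs]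
    refine Finset.sum_congr rfl fun x _ => ?_
    simp
  have := LinearMap.congr_fun hL f
  simpa [L] using this

variable (p k) in
/-- The Steinberg module is projective. -/
theorem isRelativelyProjective_steinberg :
    IsRelativelyProjective k (Grp p) (H p k (p - 1)).asModule := by
  classical
  -- The witness is `φ f = -f(0, 1) Y ^ (p - 1)`. For `g` with rows `(a, b)` and `(c, d)`, its
  -- conjugate sends `f` to `-f(c, d) (aY - bX) ^ (p - 1)`. Summing over each bottom row gives `f(c,
  -- d) (cY - dX) ^ (p - 1)`, and these add up to `f`.
  refine mem_traceHom_asModule_iff.2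
    ⟨-(LinearMap.toSpanSingleton k _ (monom k (p - 1) (p - 1)) ∘ₗ
      (aeval ![(0 : k), 1]).toLinearMap ∘ₗ Submodule.subtype _), fun f => ?_⟩
  refine Eq.trans (b := f) ?_ rfl
  refine Subtype.ext ?_
  set ι := ZMod.castHom (dvd_refl p) k
  have h1 : ∀ g : Grp p, (H p k (p - 1) g⁻¹ ((-(LinearMap.toSpanSingleton k _
      (monom k (p - 1) (p - 1)) ∘ₗ (aeval ![(0 : k), 1]).toLinearMap ∘ₗ Submodule.subtype _))
      (H p k (p - 1) g f)) : MvPolynomial (Fin 2) k) =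
      -(aeval ![ι (g.1 1 0), ι (g.1 1 1)] f.1 • linForm k (g.1 0 0) (g.1 0 1) ^ (p - 1)) := by
    intro g
    rw [LinearMap.neg_apply, map_neg, LinearMap.comp_apply, LinearMap.comp_apply,
      LinearMap.toSpanSingleton_apply, map_smul, Submodule.coe_neg, Submodule.coe_smul,
      Submodule.subtype_apply, AlgHom.toLinearMap_apply, coe_H_apply, coe_H_apply, aeval_subst,
      coe_monom le_rfl, toMat_inv, Nat.sub_self, pow_zero, one_mul, map_pow, subst_X_one]
    congr 2
    · simp [toMat, ι]
    · congr 1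
      simp [toMat, linForm]
      ring
  rw [Submodule.coe_sum, Finset.sum_congr rfl fun g _ => h1 g, Finset.sum_neg_distrib,
    ← Finset.sum_fiberwise (s := Finset.univ) (g := fun g : Grp p => (g.1 1 0, g.1 1 1)),
    ← Finset.sum_neg_distrib]
  conv_rhs => rw [← sum_aeval_smul_linForm_pow f]
  refine Finset.sum_congr rfl fun x _ => ?_
  have h2 : ∀ g ∈ Finset.univ.filter (fun g : Grp p => (g.1 1 0, g.1 1 1) = x),
      aeval ![ι (g.1 1 0), ι (g.1 1 1)] f.1 • linForm k (g.1 0 0) (g.1 0 1) ^ (p - 1) =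
      aeval ![ι x.1, ι x.2] f.1 • linForm k (g.1 0 0) (g.1 0 1) ^ (p - 1) := by
    intro g hg
    rw [← (Finset.mem_filter.1 hg).2]
  rw [Finset.sum_congr rfl h2, ← Finset.smul_sum, sum_fiber_linForm_pow x.1 x.2, smul_neg, neg_neg]

end Steinberg

end SL2Fp

/-- The tensor product of two representations is an additive group. -/
noncomputable instance Representation.addCommGroupTprodAsModule {k G U V : Type*} [CommRing k]
    [Group G] [AddCommGroup U] [Module k U] [AddCommGroup V] [Module k V]
    (τ : Representation k G U) (ρ : Representation k G V) : AddCommGroup (τ.tprod ρ).asModule :=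
  inferInstanceAs (AddCommGroup (TensorProduct k U V))

/-! ### Combinatorics of the fusion coefficients -/

section Combinatorics

/-- The fusion coefficient of `V (a + 1)`, `V (b + 1)` and `V (c + 1)`. -/
def fusionCoeff (p a b c : ℕ) : ℕ :=
  if (a + b + c) % 2 = 0 ∧ a ≤ b + c ∧ b ≤ a + c ∧ c ≤ a + b ∧ a + b + c + 3 < 2 * p then 1 else 0

theorem fusionCoeff_symm (p a b c : ℕ) : fusionCoeff p a b c = fusionCoeff p c b a :=
  if_congr (by omega) rfl rfl

theorem fusionCoeff_le_one (p a b c : ℕ) : fusionCoeff p a b c ≤ 1 := by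
  unfold fusionCoeff
  split_ifs <;> omega

theorem fusionCoeff_zero {p a c : ℕ} (ha : a < p - 1) :
    fusionCoeff p a 0 c = if c = a then 1 else 0 :=
  if_congr (by omega) rfl rfl

/-- The fusion coefficient of `V (d + 1)`, `V 2` and `V (e + 1)`. -/
def pathCoeff (d e : ℕ) : ℕ := if e = d + 1 ∨ d = e + 1 then 1 else 0

/-- The hypothesis `f m = 0` covers the right end of the path; in the application `m = p - 1` is the
degree of the Steinberg module. -/
theorem sum_mul_pathCoeff {m e : ℕ} (he : e < m) (f : ℕ → ℕ) (hf : f m = 0) :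
    ∑ d ∈ Finset.range m, f d * pathCoeff d e = (if e = 0 then 0 else f (e - 1)) + f (e + 1) := by
  have h : ∀ d, f d * pathCoeff d e =
      (if d = e - 1 then (if e = 0 then 0 else f d) else 0) + (if d = e + 1 then f d else 0) := by
    intro d
    unfold pathCoeff
    split_ifs <;> omega
  rw [Finset.sum_congr rfl fun d _ => h d, Finset.sum_add_distrib, Finset.sum_ite_eq',
    Finset.sum_ite_eq', if_pos (Finset.mem_range.2 (by omega))]
  congr 1
  split_ifs with h
  · rfl
  · rw [Finset.mem_range] at h
    rw [show e + 1 = m by omega, hf]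

theorem sum_fusionCoeff_mul_pathCoeff {p a b e : ℕ} (ha : a < p - 1) (hb : b + 1 < p - 1)
    (he : e < p - 1) : ∑ d ∈ Finset.range (p - 1), fusionCoeff p a (b + 1) d * pathCoeff d e =
      fusionCoeff p a (b + 2) e + fusionCoeff p a b e := by
  rw [sum_mul_pathCoeff he _ (if_neg (by omega))]
  unfold fusionCoeff
  split_ifs <;> omega

theorem sum_fusionCoeff_zero_mul_pathCoeff {p a e : ℕ} (ha : a < p - 1) (he : e < p - 1) :
    ∑ d ∈ Finset.range (p - 1), fusionCoeff p a 0 d * pathCoeff d e = fusionCoeff p a 1 e := by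
  rw [sum_mul_pathCoeff he _ (if_neg (by omega))]
  unfold fusionCoeff
  split_ifs <;> omega

theorem sum_fusionCoeff {p a b : ℕ} (ha : a < p - 1) (hb : b < p - 1) :
    ∑ c ∈ Finset.range (p - 1), fusionCoeff p a b c =
      min (min (a + 1) (p - (a + 1))) (min (b + 1) (p - (b + 1))) := by
  -- For `a ≤ b` the admissible values are `c = b - a + 2t`: the triangle condition gives `t ≤ a`,
  -- the truncation `t < p - (b + 1)`.
  have hle : ∀ a b, a ≤ b → b < p - 1 → ∑ c ∈ Finset.range (p - 1), fusionCoeff p a b c =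
      min (a + 1) (p - (b + 1)) := by
    intro a b hab hb
    have himg : (Finset.range (p - 1)).filter (fun c => (a + b + c) % 2 = 0 ∧ a ≤ b + c ∧
        b ≤ a + c ∧ c ≤ a + b ∧ a + b + c + 3 < 2 * p) =
        (Finset.range (min (a + 1) (p - (b + 1)))).image fun t => b - a + 2 * t := by
      ext c
      simp only [Finset.mem_filter, Finset.mem_range, Finset.mem_image]
      constructor
      · intro h
        exact ⟨(c - (b - a)) / 2, by omega, by omega⟩
      · rintro ⟨t, ht, rfl⟩
        omega
    unfold fusionCoeff
    rw [← Finset.sum_filter, Finset.sum_const, smul_eq_mul, mul_one, himg,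
      Finset.card_image_of_injective _ (fun s t h => by simpa using h), Finset.card_range]
  rcases le_total a b with h | h
  · rw [hle a b h hb]
    omega
  · have hswap : ∀ c, fusionCoeff p a b c = fusionCoeff p b a c := fun c =>
      if_congr (by omega) rfl rfl
    rw [Finset.sum_congr rfl fun c _ => hswap c, hle b a h ha]
    omega

/-- Raising `m` by one adds `1` exactly for `m ≤ a < p - 1 - m`, that is `p - 1 - 2m` times. -/
theorem sum_min_min {p m : ℕ} (hm : 2 * m ≤ p) :
    ∑ a ∈ Finset.range (p - 1), min (min (a + 1) (p - (a + 1))) m = m * (p - m) := by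
  induction m with
  | zero => simp
  | succ m ih =>
    have h : ∀ a, min (min (a + 1) (p - (a + 1))) (m + 1) = min (min (a + 1) (p - (a + 1))) m +
        if m < a + 1 ∧ m < p - (a + 1) then 1 else 0 := by
      intro a
      split_ifs <;> omega
    have hcard : (Finset.range (p - 1)).filter (fun a => m < a + 1 ∧ m < p - (a + 1)) =
        Finset.Ico m (p - 1 - m) := by
      ext a
      simp only [Finset.mem_filter, Finset.mem_range, Finset.mem_Ico]
      omega
    rw [Finset.sum_congr rfl fun a _ => h a, Finset.sum_add_distrib, ih (by omega),
      ← Finset.sum_filter, Finset.sum_const, smul_eq_mul, mul_one, hcard, Nat.card_Ico]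
    obtain ⟨q, rfl⟩ := Nat.exists_eq_add_of_le hm
    rw [show 2 * (m + 1) + q - m = m + q + 2 by omega,
      show 2 * (m + 1) + q - 1 - m - m = q + 1 by omega,
      show 2 * (m + 1) + q - (m + 1) = m + q + 1 by omega]
    ring

end Combinatorics

/-! ### The truncated Clebsch–Gordan rule -/

namespace SL2Fp

open Representation MvPolynomial

section Fusion

variable {p : ℕ} {k : Type*} [Field k] [CharP k p]
variable {U : Type*} [AddCommGroup U] [Module k U] (τ : Representation k (Grp p) U)

theorem H_zero_apply (g : Grp p) (f : homogeneousSubmodule (Fin 2) k 0) : H p k 0 g f = f := by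
  obtain ⟨c, hc⟩ := exists_eq_C_of_degree_zero f
  refine Subtype.ext ?_
  rw [coe_H_apply, hc, subst_C]

/-- Tensoring with the constants does nothing. -/
noncomputable def tprodZeroEquiv :
    τ.asModule ≃ₗ[MonoidAlgebra k (Grp p)] (τ.tprod (H p k 0)).asModule :=
  let e := (((coordEquiv k 0).trans (LinearEquiv.funUnique (Fin 1) k k)).lTensor U).trans
    (TensorProduct.rid k U)
  (LinearEquiv.ofBijective (toModuleHom (ρ := τ.tprod (H p k 0)) (σ := τ) e.toLinearMap fun g v => by
    induction v using TensorProduct.induction_on with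
    | zero => simp
    | tmul x y => simp [e, H_zero_apply]
    | add x y hx hy => rw [map_add, map_add, hx, hy, map_add, map_add]) e.bijective).symm

variable {V W : Type*} [AddCommGroup V] [Module k V] [AddCommGroup W] [Module k W]

/-- Tensoring on the left, on isomorphisms. -/
noncomputable def lTensorEquiv {ρ : Representation k (Grp p) V} {σ : Representation k (Grp p) W}
    (e : ρ.asModule ≃ₗ[MonoidAlgebra k (Grp p)] σ.asModule) :
    (τ.tprod ρ).asModule ≃ₗ[MonoidAlgebra k (Grp p)] (τ.tprod σ).asModule :=
  LinearEquiv.ofLinearMap (lTensorHom τ e.toLinearMap) (lTensorHom τ e.symm.toLinearMap)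
    (by rw [← lTensorHom_comp, LinearEquiv.comp_symm, lTensorHom_id])
    (by rw [← lTensorHom_comp, LinearEquiv.symm_comp, lTensorHom_id])

theorem exists_double_split {d : ℕ} (hd : ((d + 2 : ℕ) : k) ≠ 0) :
    ∃ (ι₁ : (H p k (d + 2)).asModule →ₗ[MonoidAlgebra k (Grp p)] (double (H p k (d + 1))).asModule)
      (π₁ : (double (H p k (d + 1))).asModule →ₗ[MonoidAlgebra k (Grp p)] (H p k (d + 2)).asModule)
      (ι₂ : (H p k d).asModule →ₗ[MonoidAlgebra k (Grp p)] (double (H p k (d + 1))).asModule)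
      (π₂ : (double (H p k (d + 1))).asModule →ₗ[MonoidAlgebra k (Grp p)] (H p k d).asModule),
      π₁ ∘ₗ ι₁ = LinearMap.id ∧ π₂ ∘ₗ ι₂ = LinearMap.id ∧ π₁ ∘ₗ ι₂ = 0 ∧ π₂ ∘ₗ ι₁ = 0 ∧
      ι₁ ∘ₗ π₁ + ι₂ ∘ₗ π₂ = LinearMap.id := by
  refine ⟨gradHom p k (d + 1), ((d + 2 : ℕ) : k)⁻¹ • mulHom p k (d + 1), rotHom p k d,
    ((d + 2 : ℕ) : k)⁻¹ • curlHom p k d, ?_, ?_, ?_, ?_, ?_⟩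
  · rw [LinearMap.smul_comp, mulHom_comp_gradHom, smul_smul, inv_mul_cancel₀ hd, one_smul]
  · rw [LinearMap.smul_comp, curlHom_comp_rotHom, smul_smul, inv_mul_cancel₀ hd, one_smul]
  · rw [LinearMap.smul_comp, mulHom_comp_rotHom, smul_zero]
  · rw [LinearMap.smul_comp, curlHom_comp_gradHom, smul_zero]
  · rw [LinearMap.comp_smul, LinearMap.comp_smul, ← smul_add, gradHom_mulHom_add_rotHom_curlHom,
      smul_smul, inv_mul_cancel₀ hd, one_smul]

theorem natCast_ne_zero_of_lt {d : ℕ} (h0 : 0 < d) (hd : d < p) : (d : k) ≠ 0 := by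
  rw [Ne, CharP.cast_eq_zero_iff k p]
  exact fun h => absurd (Nat.le_of_dvd h0 h) (by omega)

variable [Fact p.Prime]

theorem hasSplitType_H {d : ℕ} (hd : d < p) :
    HasSplitType k (Grp p) (fun d : Fin (p - 1) => (H p k d).asModule) (H p k d).asModule
      (fun e => if (e : ℕ) = d then 1 else 0) := by
  -- The Steinberg degree lies outside `Fin (p - 1)`, so its type is zero.
  by_cases h : d = p - 1
  · have h0 : (fun e : Fin (p - 1) => if (e : ℕ) = d then 1 else 0) = (0 : Fin (p - 1) → ℕ) :=
      funext fun e => if_neg (by omega)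
    rw [h0, h]
    exact .of_isRelativelyProjective (isRelativelyProjective_steinberg p k)
  · have h0 : (fun e : Fin (p - 1) => if (e : ℕ) = d then 1 else 0) =
        Pi.single (⟨d, by omega⟩ : Fin (p - 1)) 1 := by
      funext e
      rw [Pi.single_apply]
      exact if_congr ⟨fun h => Fin.ext h, fun h => congrArg Fin.val h⟩ rfl rfl
    rw [h0]
    exact HasSplitType.single (S := fun d : Fin (p - 1) => (H p k d).asModule) ⟨d, by omega⟩

theorem hasSplitType_double_H (hp : 2 < p) {d : ℕ} (hd : d < p - 1) :
    HasSplitType k (Grp p) (fun d : Fin (p - 1) => (H p k d).asModule) (double (H p k d)).asModule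
      (fun e => pathCoeff d e) := by
  cases d with
  | zero =>
    have h := (hasSplitType_H (p := p) (k := k) (d := 1) (by omega)).congr
      (N := (H p k 1).asModule) (M := (double (H p k 0)).asModule) (doubleZeroEquiv p k)
    have hc : (fun e : Fin (p - 1) => pathCoeff 0 e) = fun e : Fin (p - 1) =>
        if (e : ℕ) = 1 then 1 else 0 := by
      funext e
      simp [pathCoeff]
    rw [hc]
    exact h
  | succ d =>
    obtain ⟨ι₁, π₁, ι₂, π₂, h11, h22, h12, h21, h⟩ :=
      exists_double_split (p := p) (k := k) (d := d) (natCast_ne_zero_of_lt (by omega) (by omega))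
    have h := (hasSplitType_H (p := p) (k := k) (d := d + 2) (by omega)).add
      (M := (double (H p k (d + 1))).asModule) (N := (H p k (d + 2)).asModule)
      (L := (H p k d).asModule) (hasSplitType_H (p := p) (k := k) (d := d) (by omega)) ι₁ π₁ ι₂ π₂ h11 h22 h12 h21 h
    convert h using 1
    funext e
    simp only [pathCoeff, Pi.add_apply]
    split_ifs <;> omega

theorem hasSplitType_tprod_double (hp : 2 < p) {ρ : Representation k (Grp p) V} {c : ℕ → ℕ}
    (h : HasSplitType k (Grp p) (fun d : Fin (p - 1) => (H p k d).asModule) (τ.tprod ρ).asModule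
      (fun e => c e)) :
    HasSplitType k (Grp p) (fun d : Fin (p - 1) => (H p k d).asModule) (τ.tprod (double ρ)).asModule
      (fun e => ∑ d ∈ Finset.range (p - 1), c d * pathCoeff d e) := by
  have := (HasSplitType.double (fun d => hasSplitType_double_H hp d.2) h).congr
    (tprodDouble ρ τ).symm
  convert this using 2 with e
  rw [Finset.sum_apply, Finset.sum_range]
  rfl

theorem hasSplitType_tprod_zero {a : ℕ} (ha : a < p - 1) :
    HasSplitType k (Grp p) (fun d : Fin (p - 1) => (H p k d).asModule)
      ((H p k a).tprod (H p k 0)).asModule (fun c => fusionCoeff p a 0 c) := by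
  have h := (hasSplitType_H (p := p) (k := k) (d := a) (by omega)).congr
    (N := (H p k a).asModule) (M := ((H p k a).tprod (H p k 0)).asModule) (tprodZeroEquiv (H p k a))
  have hc : (fun e : Fin (p - 1) => fusionCoeff p a 0 e) = fun e : Fin (p - 1) =>
      if (e : ℕ) = a then 1 else 0 :=
    funext fun e => fusionCoeff_zero ha
  rw [hc]
  exact h

theorem hasSplitType_tprod_one (hp : 2 < p) {a : ℕ} (ha : a < p - 1) :
    HasSplitType k (Grp p) (fun d : Fin (p - 1) => (H p k d).asModule)
      ((H p k a).tprod (H p k 1)).asModule (fun c => fusionCoeff p a 1 c) := by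
  have h := (hasSplitType_tprod_double (ρ := H p k 0) (c := fun c => fusionCoeff p a 0 c) (H p k a)
    hp (hasSplitType_tprod_zero ha)).congr
    (N := ((H p k a).tprod (double (H p k 0))).asModule)
    (M := ((H p k a).tprod (H p k 1)).asModule)
    (lTensorEquiv (H p k a) (doubleZeroEquiv p k)).symm
  have hc : (fun e : Fin (p - 1) => fusionCoeff p a 1 e) = fun e : Fin (p - 1) =>
      ∑ d ∈ Finset.range (p - 1), fusionCoeff p a 0 d * pathCoeff d e :=
    funext fun e => (sum_fusionCoeff_zero_mul_pathCoeff ha e.2).symm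
  rw [hc]
  exact h

/-- The type of `H a ⊗ double (H (b + 1))` is computed twice: by doubling `H a ⊗ H (b + 1)`, and
from its summands `H a ⊗ H (b + 2)` and `H a ⊗ H b`. The first summand has some type because it is a
retract, and uniqueness equates the two results. -/
theorem hasSplitType_tprod_add_two (hp : 2 < p) {a b : ℕ} (hb : b + 2 < p) {c c' : ℕ → ℕ}
    (h : HasSplitType k (Grp p) (fun d : Fin (p - 1) => (H p k d).asModule)
      ((H p k a).tprod (H p k b)).asModule (fun e => c e))
    (h' : HasSplitType k (Grp p) (fun d : Fin (p - 1) => (H p k d).asModule)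
      ((H p k a).tprod (H p k (b + 1))).asModule (fun e => c' e)) :
    ∃ c'' : Fin (p - 1) → ℕ,
      HasSplitType k (Grp p) (fun d : Fin (p - 1) => (H p k d).asModule)
        ((H p k a).tprod (H p k (b + 2))).asModule c'' ∧
      ∀ e : Fin (p - 1), ∑ d ∈ Finset.range (p - 1), c' d * pathCoeff d e = c'' e + c e := by
  have hS := isSplitFamily_H p k
  have hD := hasSplitType_tprod_double (ρ := H p k (b + 1)) (H p k a) hp h'
  obtain ⟨ι₁, π₁, ι₂, π₂, h11, h22, h12, h21, hsum⟩ :=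
    exists_double_split (p := p) (k := k) (d := b) (natCast_ne_zero_of_lt (by omega) hb)
  have hfin : FiniteDimensional k ((H p k a).tprod (H p k (b + 2))).asModule :=
    inferInstanceAs (FiniteDimensional k (TensorProduct k
      (homogeneousSubmodule (Fin 2) k a) (homogeneousSubmodule (Fin 2) k (b + 2))))
  have h11' : lTensorHom (H p k a) π₁ ∘ₗ lTensorHom (H p k a) ι₁ = LinearMap.id := by
    rw [← lTensorHom_comp, h11, lTensorHom_id]
  have h22' : lTensorHom (H p k a) π₂ ∘ₗ lTensorHom (H p k a) ι₂ = LinearMap.id := by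
    rw [← lTensorHom_comp, h22, lTensorHom_id]
  have h12' : lTensorHom (H p k a) π₁ ∘ₗ lTensorHom (H p k a) ι₂ = 0 := by
    rw [← lTensorHom_comp, h12, lTensorHom_zero]
  have h21' : lTensorHom (H p k a) π₂ ∘ₗ lTensorHom (H p k a) ι₁ = 0 := by
    rw [← lTensorHom_comp, h21, lTensorHom_zero]
  have hsum' : lTensorHom (H p k a) ι₁ ∘ₗ lTensorHom (H p k a) π₁ +
      lTensorHom (H p k a) ι₂ ∘ₗ lTensorHom (H p k a) π₂ = LinearMap.id := by
    rw [← lTensorHom_comp, ← lTensorHom_comp, ← lTensorHom_add, hsum, lTensorHom_id]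
  generalize lTensorHom (H p k a) ι₁ = i₁ at *
  generalize lTensorHom (H p k a) ι₂ = i₂ at *
  generalize lTensorHom (H p k a) π₁ = q₁ at *
  generalize lTensorHom (H p k a) π₂ = q₂ at *
  obtain ⟨c'', hc''⟩ := hS.exists_hasSplitType (IsStablySplit.of_retract
    (M := ((H p k a).tprod (double (H p k (b + 1)))).asModule)
    (N := ((H p k a).tprod (H p k (b + 2))).asModule) hD.isStablySplit i₁ q₁ h11')
  refine ⟨c'', hc'', fun e => ?_⟩
  have hadd := HasSplitType.add (M := ((H p k a).tprod (double (H p k (b + 1)))).asModule)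
    (N := ((H p k a).tprod (H p k (b + 2))).asModule) (L := ((H p k a).tprod (H p k b)).asModule)
    hc'' h i₁ q₁ i₂ q₂ h11' h22' h12' h21' hsum'
  exact congrFun (hS.hasSplitType_unique hD hadd) e

/-- The fusion coefficients satisfy the same three-term recurrence in `b`, with the same first two
terms. -/
theorem hasSplitType_tprod (hp : 2 < p) {a b : ℕ} (ha : a < p - 1) (hb : b < p - 1) :
    HasSplitType k (Grp p) (fun d : Fin (p - 1) => (H p k d).asModule)
      ((H p k a).tprod (H p k b)).asModule (fun c => fusionCoeff p a b c) := by
  induction b using Nat.twoStepInduction with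
  | zero => exact hasSplitType_tprod_zero ha
  | one => exact hasSplitType_tprod_one hp ha
  | more b ih ih' =>
    obtain ⟨c, hc, hce⟩ := hasSplitType_tprod_add_two hp (by omega) (ih (by omega)) (ih' (by omega))
    have hcf : (fun e : Fin (p - 1) => fusionCoeff p a (b + 2) e) = c := by
      funext e
      have := hce e
      rw [sum_fusionCoeff_mul_pathCoeff ha (by omega) e.2] at this
      omega
    rw [hcf]
    exact hc

end Fusion

/-! ### The graph and its degrees -/

section Graph

variable {p : ℕ} {k : Type*} [Field k] [CharP k p]

theorem sum_vertex (f : ℕ → ℕ) :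
    ∑ i : Vertex p, f i = ∑ a ∈ Finset.range (p - 1), f (a + 1) := by
  rw [Finset.sum_coe_sort (Finset.Icc 1 (p - 1)) f]
  refine Finset.sum_nbij' (· - 1) (· + 1) ?_ ?_ ?_ ?_ ?_
  all_goals
    intro a ha
    simp only [Finset.mem_Icc, Finset.mem_range] at ha ⊢
  · omega
  · omega
  · omega
  · omega
  · rw [Nat.sub_add_cancel ha.1]

variable [Fact p.Prime]

/-- The shift by one passes from dimension to degree; `V p k i` is by definition `H p k (i - 1)`. -/
theorem A_apply (hp : 2 < p) {n : ℕ} (hn₁ : 1 ≤ n) (hn₂ : n ≤ p - 1) (i j : Vertex p) :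
    A p k n i j = fusionCoeff p (i - 1) (n - 1) (j - 1) := by
  have hi := Finset.mem_Icc.1 i.2
  have hj := Finset.mem_Icc.1 j.2
  exact (isSplitFamily_H p k).summandMultiplicity_eq
    (hasSplitType_tprod hp (a := i - 1) (b := n - 1) (by omega) (by omega))
    ⟨j - 1, by omega⟩

theorem loopDegree_graph (hp : 2 < p) {n : ℕ} (hn₁ : 1 ≤ n) (hn₂ : n ≤ p - 1) (i : Vertex p) :
    loopDegree (graph p k n) i = ∑ c ∈ Finset.range (p - 1), fusionCoeff p (i - 1) (n - 1) c := by
  classical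
  have h : ∑ c ∈ Finset.range (p - 1), fusionCoeff p (i - 1) (n - 1) c =
      ∑ j : Vertex p, fusionCoeff p (i - 1) (n - 1) (j - 1) := by
    rw [sum_vertex fun j => fusionCoeff p (i - 1) (n - 1) (j - 1)]
    rfl
  rw [h, loopDegree, Set.ncard_eq_toFinset_card', Set.toFinset_ofPred, Finset.card_filter]
  -- The entries are `0` or `1`, so counting neighbours is summing a row.
  refine Finset.sum_congr rfl fun j _ => ?_
  have hle := fusionCoeff_le_one p (i - 1) (n - 1) (j - 1)
  have hadj : (graph p k n).Adj i j ↔ fusionCoeff p (i - 1) (n - 1) (j - 1) ≠ 0 := by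
    change A p k n i j ≠ 0 ↔ _
    rw [A_apply hp hn₁ hn₂]
  split_ifs with h <;> rw [hadj] at h <;> omega

theorem loopDegree_graph_eq_min (hp : 2 < p) {n : ℕ} (hn₁ : 1 ≤ n) (hn₂ : n ≤ p - 1)
    (i : Vertex p) :
    loopDegree (graph p k n) i = min (min (i : ℕ) (p - i)) (min n (p - n)) := by
  have hi := Finset.mem_Icc.1 i.2
  rw [loopDegree_graph hp hn₁ hn₂, sum_fusionCoeff (by omega) (by omega),
    Nat.sub_add_cancel hi.1, Nat.sub_add_cancel hn₁]

end Graph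

end SL2Fp

theorem lemma4p12 (p : ℕ) [Fact p.Prime] (hp : 2 < p)
    (k : Type*) [Field k] [IsAlgClosed k] [CharP k p]
    (n : ℕ) (hn₁ : 1 ≤ n) (hn₂ : n ≤ p - 1) :
    -- the matrix is a symmetric 0-1 matrix, so it is the adjacency matrix of an undirected graph
    ((SL2Fp.A p k n).IsSymm ∧ ∀ i j : SL2Fp.Vertex p, SL2Fp.A p k n i j ≤ 1) ∧
    -- the degree is the number of non-projective summands of the tensor product, in any
    -- decomposition into indecomposable summands (and such a decomposition exists)
    (∀ i : SL2Fp.Vertex p,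
      (∃ (r : ℕ) (W : Fin r →
          Submodule (MonoidAlgebra k (SL2Fp.Grp p)) (SL2Fp.TensorMod p k i n)),
        IsIndecomposableDecomposition W) ∧
      ∀ (r : ℕ) (W : Fin r →
          Submodule (MonoidAlgebra k (SL2Fp.Grp p)) (SL2Fp.TensorMod p k i n)),
        IsIndecomposableDecomposition W →
          loopDegree (SL2Fp.graph p k n) i = numNonProjective W) ∧
    (∀ i : SL2Fp.Vertex p,
      loopDegree (SL2Fp.graph p k n) i = min (min (i : ℕ) (p - i)) (min n (p - n))) ∧
    ∑ i : SL2Fp.Vertex p, loopDegree (SL2Fp.graph p k n) i = n * (p - n) := by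
  refine ⟨⟨?_, fun i j => ?_⟩, fun i => ⟨?_, fun r W hW => ?_⟩,
    SL2Fp.loopDegree_graph_eq_min hp hn₁ hn₂, ?_⟩
  · refine Matrix.IsSymm.ext fun i j => ?_
    rw [SL2Fp.A_apply hp hn₁ hn₂, SL2Fp.A_apply hp hn₁ hn₂, fusionCoeff_symm]
  · rw [SL2Fp.A_apply hp hn₁ hn₂]
    exact fusionCoeff_le_one _ _ _ _
  · have hfin : FiniteDimensional k (SL2Fp.TensorMod p k i n) :=
      inferInstanceAs (FiniteDimensional k (TensorProduct k
        (MvPolynomial.homogeneousSubmodule (Fin 2) k _)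
        (MvPolynomial.homogeneousSubmodule (Fin 2) k _)))
    exact exists_isIndecomposableDecomposition k (SL2Fp.TensorMod p k i n)
  · have hi := Finset.mem_Icc.1 i.2
    rw [SL2Fp.loopDegree_graph hp hn₁ hn₂, Finset.sum_range]
    exact (numNonProjective_eq_sum (SL2Fp.isSplitFamily_H p k)
      (SL2Fp.hasSplitType_tprod hp (a := i - 1) (b := n - 1) (by omega) (by omega)) W hW).symm
  · rw [Finset.sum_congr rfl fun i _ => SL2Fp.loopDegree_graph_eq_min hp hn₁ hn₂ i,
      SL2Fp.sum_vertex fun i => min (min i (p - i)) (min n (p - n)), sum_min_min (by omega)]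
    -- The sum is `m (p - m)` with `m = min n (p - n)`, an expression unchanged by `m ↦ p - m`.
    rcases le_total n (p - n) with h | h
    · rw [min_eq_left h]
    · rw [min_eq_right h, Nat.sub_sub_self (by omega), mul_comm]
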